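/- Let $d\ge 5$ and let $T$ be the Cayley tree (Bethe lattice) of degree $d$, i.e. an infinite tree all of whose vertices have degree $d$, with a root $\bar 0$. Let $T_n$ be the set of vertices at distance at most $n$ from $\bar 0$, and let $\partial T_n$ be the set of vertices at distance exactly $n+1$. Each vertex carries a spin $d/2$, with state space $\mathbb C^{d+1}$ realized as the homogeneous polynomials of degree $d$ in $u_x,v_x$, with orthonormal basis $\sqrt{(d+1)\binom dj}\,u_x^jv_x^{d-j}$ ($0\le j\le d$). Put $\mathcal A_n=\bigotimes_{x\in T_n}M_{d+1}(\mathbb C)$, and let $\mathcal A$ be the quasi-local algebra, the norm completion of $\bigcup_n\mathcal A_n$ under the inclusions $A\mapsto A\otimes 1$. The AKLT Hamiltonian of $T_n$ is $H_n=\sum_{(x,y)}P_{xy}$, summed over the edges with both ends in $T_n$, where $P_{xy}$ is the orthogonal projection onto the states in which the spins at $x$ and $y$ have the maximal total spin $d$. Let $\psi_n:(\mathbb C^2)^{\otimes\partial T_n}\to(\mathbb C^{d+1})^{\otimes T_n}$ be the valence bond map: the matrix element of $\psi_n$ between a product basis vector of the spins in $T_n$ and a product basis vector of the spins $\tfrac12$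 in $\partial T_n$ is the coefficient (with respect to the above orthonormal basis at the vertices of $T_n$, and the basis $u_y,v_y$ at those of $\partial T_n$) of the polynomial $\prod_{(x,y)}(u_xv_y-v_xu_y)$, where the product is over all edges with $x\in T_n$, $y\in T_n\cup\partial T_n$, oriented away from the root. For a positive semidefinite boundary condition $B\in M_2(\mathbb C)^{\otimes\partial T_n}$ with $\operatorname{Tr}(\psi_nB\psi_n^*)\ne0$ let $$\omega^n_B(A)=\frac{\operatorname{Tr}(\psi_nB\psi_n^*A)}{\operatorname{Tr}(\psi_nB\psi_n^*)}\qquad(A\in\mathcal A_n).$$ An infinite-volume ground state is a functional $\omega:\mathcal A\to\mathbb C$ for which there are such boundary conditions $B_n$ on $T_n$, $n\ge0$, for which the finite-volume states are ground states ($H_n\psi_nB_n\psi_n^*=0$) and $\omega(A)=\lim_{n\to\infty}\omega^n_{B_n}(A_n)$ for every $A\in\mathcal A$ and all $A_n\in\mathcal A_n$ with $A_n\to A$ in norm. **Theorem.** For $d\ge5$ the AKLT infinite-volume ground state on the Cayley tree of degree $d$ is not unique: there are two different infinite-volume ground states $\omega_1\neq\omega_2$. -/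

import Mathlib

open scoped ComplexOrder

namespace AKLT

variable {V : Type*}

/-! ## Layers and volumes of a rooted, locally finite graph -/

theorem finite_ball (G : SimpleGraph V) [G.LocallyFinite] (o : V) (n : ℕ) :
    {x : V | G.edist o x ≤ n}.Finite := by
  have key : ∀ n : ℕ, {x : V | ∃ p : G.Walk x o, p.length ≤ n}.Finite := by
    intro n
    induction n with
    | zero =>
      refine (Set.finite_singleton o).subset ?_
      rintro x ⟨p, hp⟩
      exact SimpleGraph.Walk.eq_of_length_eq_zero (Nat.le_zero.mp hp)
    | succ n ih =>
      refine ((Set.finite_singleton o).union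
        (ih.biUnion (fun y _ => (G.neighborSet y).toFinite))).subset ?_
      rintro x ⟨p, hp⟩
      cases p with
      | nil => exact Or.inl rfl
      | cons h q =>
        refine Or.inr (Set.mem_biUnion (show _ from ⟨q, ?_⟩) h.symm)
        simpa using hp
  refine (key n).subset ?_
  intro x hx
  have hne : G.edist o x ≠ ⊤ := ne_top_of_le_ne_top (ENat.natCast_ne_top n) hx
  obtain ⟨p, hp⟩ := SimpleGraph.exists_walk_of_edist_ne_top hne
  refine ⟨p.reverse, ?_⟩
  have : ((p.length : ℕ) : ℕ∞) ≤ n := hp ▸ hx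
  simpa using this

/-- The vertices of the finite tree `T_n`: those at distance at most `n` from the root `o`. -/
noncomputable def ball (G : SimpleGraph V) [G.LocallyFinite] (o : V) (n : ℕ) : Finset V :=
  (finite_ball G o n).toFinset

/-- The `n`-th layer: the vertices at distance exactly `n` from the root `o`. -/
noncomputable def layer (G : SimpleGraph V) [G.LocallyFinite] (o : V) (n : ℕ) : Finset V :=
  ((finite_ball G o n).subset
    (fun _ hx => le_of_eq hx : {x : V | G.edist o x = n} ⊆ {x : V | G.edist o x ≤ n})).toFinset

theorem ball_mono (G : SimpleGraph V) [G.LocallyFinite] (o : V) {m n : ℕ} (h : m ≤ n) :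
    ball G o m ⊆ ball G o n := by
  intro x hx
  simp only [ball, Set.Finite.mem_toFinset, Set.mem_ofPred_eq] at hx ⊢
  exact hx.trans (by exact_mod_cast h)

/-- `(x, y)` is an edge of the tree, oriented away from the root `o`. -/
def IsEdge (G : SimpleGraph V) (o x y : V) : Prop :=
  G.Adj x y ∧ G.dist o y = G.dist o x + 1

/-! ## Spins

A site carries a spin `d/2`.  In the Weyl representation its state space consists of the
homogeneous polynomials of degree `d` in `u, v`, with the orthonormal basis
`√((d + 1) * d.choose j) * u ^ j * v ^ (d - j)`, `j = 0, …, d`, in which all operators and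
vectors below are written. -/

/-- The raising operator `S⁺ = u ∂/∂v`. -/
noncomputable def spinPlus (d : ℕ) : Matrix (Fin (d + 1)) (Fin (d + 1)) ℂ :=
  Matrix.of fun i j =>
    if (i : ℕ) = (j : ℕ) + 1 then ((Real.sqrt (((d : ℝ) - (j : ℕ)) * ((j : ℕ) + 1)) : ℝ) : ℂ) else 0

/-- The spin operators `S^x, S^y, S^z` of spin `d/2`, where `S^± = S^x ± i S^y` and
`S^z = (u ∂/∂u - v ∂/∂v) / 2`. -/
noncomputable def spin (d : ℕ) : Fin 3 → Matrix (Fin (d + 1)) (Fin (d + 1)) ℂ :=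
  ![(1 / 2 : ℂ) • (spinPlus d + (spinPlus d).conjTranspose),
    (1 / (2 * Complex.I) : ℂ) • (spinPlus d - (spinPlus d).conjTranspose),
    Matrix.diagonal fun j => ((j : ℕ) : ℂ) - (d : ℂ) / 2]

section Volume

variable [DecidableEq V] (G : SimpleGraph V) [G.LocallyFinite] (o : V) (d n : ℕ)

/-- Labels of the product orthonormal basis of `⨂_{x ∈ T_n} ℂ^{d+1}`. -/
abbrev Config : Type _ := ↥(ball G o n) → Fin (d + 1)

/-- Labels of the product basis of `⨂_{y ∈ ∂T_n} ℂ²`, where `∂T_n` is layer `n + 1`;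
the value `1` stands for spin up and `0` for spin down. -/
abbrev BdryConfig : Type _ := ↥(layer G o (n + 1)) → Fin 2

/-- The algebra of observables of the volume `T_n`. -/
abbrev Obs : Type _ := Matrix (Config G o d n) (Config G o d n) ℂ

variable {d n}

/-- The operator acting as `M` at the site `x` and as the identity at all other sites. -/
noncomputable def siteOp (x : ↥(ball G o n)) (M : Matrix (Fin (d + 1)) (Fin (d + 1)) ℂ) :
    Obs G o d n :=
  open Classical in
  Matrix.of fun s t => if ∀ z, z ≠ x → s z = t z then M (s x) (t x) else 0

/-- The square of the total spin of the two sites `x` and `y`. -/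
noncomputable def totalSpinSq (x y : ↥(ball G o n)) : Obs G o d n :=
  ∑ a : Fin 3, (siteOp G o x (spin d a) + siteOp G o y (spin d a)) ^ 2

/-- The subspace on which the sites `x` and `y` have the maximal total spin `d = d/2 + d/2`:
the eigenspace of the squared total spin for the eigenvalue `d (d + 1)`. -/
noncomputable def maxSpinSpace (x y : ↥(ball G o n)) :
    Submodule ℂ (EuclideanSpace ℂ (Config G o d n)) :=
  Module.End.eigenspace (Matrix.toEuclideanLin (totalSpinSq (d := d) G o x y))
    ((d : ℂ) * ((d : ℂ) + 1))

variable (d n)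

/-- The AKLT Hamiltonian of the volume `T_n`: the sum over the edges of `T_n` of the orthogonal
projections onto maximal total spin. -/
noncomputable def hamiltonian :
    EuclideanSpace ℂ (Config G o d n) →L[ℂ] EuclideanSpace ℂ (Config G o d n) :=
  open Classical in
  ∑ x : ↥(ball G o n), ∑ y : ↥(ball G o n),
    if IsEdge G o x y then (maxSpinSpace (d := d) G o x y).starProjection else 0

/-- The product of the singlets `u_x v_y - v_x u_y` over all edges `(x, y)` of `T_n`, including
those which join the last layer of `T_n` to the boundary `∂T_n`.  The variables are
`u_x = X (x, 0)` and `v_x = X (x, 1)`. -/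
noncomputable def vbsPoly : MvPolynomial (V × Fin 2) ℂ :=
  open Classical in
  ∏ x ∈ ball G o n, ∏ y ∈ ball G o (n + 1),
    if IsEdge G o x y then
      MvPolynomial.X (x, 0) * MvPolynomial.X (y, 1) - MvPolynomial.X (x, 1) * MvPolynomial.X (y, 0)
    else 1

variable {d n}

/-- The exponents of `∏_{x ∈ T_n} u_x ^ s_x v_x ^ (d - s_x) ∏_{y ∈ ∂T_n} u_y ^ τ_y v_y ^ (1 - τ_y)`.
-/
noncomputable def exponents (s : Config G o d n) (τ : BdryConfig G o n) : V × Fin 2 →₀ ℕ :=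
  (∑ x : ↥(ball G o n), (Finsupp.single ((x : V), 0) (s x : ℕ)
      + Finsupp.single ((x : V), 1) (d - (s x : ℕ))))
    + ∑ y : ↥(layer G o (n + 1)), (Finsupp.single ((y : V), 0) (τ y : ℕ)
      + Finsupp.single ((y : V), 1) (1 - (τ y : ℕ)))

variable (d n)

/-- The linear map `ψ_n : ⨂_{y ∈ ∂T_n} ℂ² → ⨂_{x ∈ T_n} ℂ^{d+1}` which sends a vector of the
boundary spins to the AKLT (valence bond) vector of `T_n` with that boundary condition, written in
the orthonormal bases. -/
noncomputable def vbs : Matrix (Config G o d n) (BdryConfig G o n) ℂ :=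
  Matrix.of fun s τ => (vbsPoly G o n).coeff (exponents G o s τ) *
    ∏ x : ↥(ball G o n), ((Real.sqrt (((d : ℝ) + 1) * (d.choose (s x : ℕ) : ℝ)) : ℝ) : ℂ)⁻¹

variable {d n}

/-- The density matrix `ψ_n B ψ_n* / Tr (ψ_n B ψ_n*)` of the finite-volume state on `T_n` with
boundary condition `B`, a matrix in `M_2^{⊗ ∂T_n}`. -/
noncomputable def density (B : Matrix (BdryConfig G o n) (BdryConfig G o n) ℂ) : Obs G o d n :=
  ((vbs G o d n * B * (vbs G o d n).conjTranspose).trace)⁻¹ •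
    (vbs G o d n * B * (vbs G o d n).conjTranspose)

/-- `ρ` is the density matrix of a ground state of the AKLT Hamiltonian of `T_n`: it is positive
of trace one, and has energy zero for the (nonnegative) Hamiltonian. -/
def IsFiniteVolumeGroundState (ρ : Obs G o d n) : Prop :=
  ρ.PosSemidef ∧ ρ.trace = 1 ∧
    ∀ φ : EuclideanSpace ℂ (Config G o d n), hamiltonian G o d n (Matrix.toEuclideanLin ρ φ) = 0

/-! ## Infinite volume -/

/-- The inclusion `A ↦ A ⊗ 1` of the observables of `T_m` into those of `T_n`, `m ≤ n`. -/
noncomputable def embed {m n : ℕ} (h : m ≤ n) (A : Obs G o d m) : Obs G o d n :=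
  open Classical in
  Matrix.of fun s t =>
    if ∀ z : ↥(ball G o n), (z : V) ∉ ball G o m → s z = t z then
      A (fun x => s ⟨x, ball_mono G o h x.2⟩) (fun x => t ⟨x, ball_mono G o h x.2⟩)
    else 0

variable (d)

/-- A quasi-local observable, i.e. an element of the completion of `⋃_n Obs n` in the operator
norm, given by a Cauchy sequence of local observables `obs n` of `T_n`.  (Sequences with
`‖obs n - obs' n‖ → 0` represent the same element, and get the same value in each limit of
states.) A local observable `A` of `T_m` is represented by `A ⊗ 1`, for `n ≥ m`. -/
structure QuasiLocalObs where
  obs : ∀ n : ℕ, Obs G o d n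
  cauchy : ∀ ε : ℝ, 0 < ε → ∃ N : ℕ, ∀ (n : ℕ) (h : N ≤ n),
    ‖Matrix.toEuclideanCLM (𝕜 := ℂ) (obs n - embed G o h (obs N))‖ ≤ ε

variable {d}

/-- `ω` is an infinite-volume ground state: there is a sequence of boundary conditions `B n` on
`T_n` such that the states on `T_n` with these boundary conditions are ground states of the
finite-volume Hamiltonians and converge weakly to `ω`. -/
def IsInfiniteVolumeGroundState (ω : QuasiLocalObs G o d → ℂ) : Prop :=
  ∃ B : ∀ n : ℕ, Matrix (BdryConfig G o n) (BdryConfig G o n) ℂ,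
    (∀ n, (B n).PosSemidef ∧ IsFiniteVolumeGroundState G o (density (d := d) G o (B n))) ∧
    ∀ A : QuasiLocalObs G o d,
      Filter.Tendsto (fun n => (density (d := d) G o (B n) * A.obs n).trace) Filter.atTop
        (nhds (ω A))

end Volume

end AKLT

/-! Use diagonal product boundary conditions giving every boundary spin the same unnormalized
weights `b 0`, `b 1` of down and up. Tracing out the last layer of `ψ_{n+1} B ψ_{n+1}*` yields `ψ_n
B' ψ_n*`, where `B'` is again a diagonal product, now with weights `transferWeight d b`
(`sum_unnormalized_succ`). The quantum problem thus reduces to iterating a map on pairs of positive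
numbers, considered up to scale.

With `m = d - 1` the binomial coefficients cancel, and the new weights are proportional to `∑ (m + 1
- j) b₀^j b₁^(m-j)` and `∑ (j + 1) b₀^j b₁^(m-j)`. Equal weights are always a fixed point. For `d ≥
5` the intermediate value theorem also gives a two-cycle, up to a factor `c`, between `(r, 1)` and
`(1, r)` with `0 < r < 1` (`exists_weight_ratio`, `exists_neelWeight`). This is antiferromagnetic
Néel order: the bias alternates from layer to layer.

Alternating the weights with `n` makes the states on the `T_n` restrict to each other
(`trace_density_mul_embed`). On a local observable the sequence is then eventually constant, and the
bound `|Tr ρA| ≤ ‖A‖` extends convergence to quasi-local observables. The finite-volume states have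
zero energy because the valence bond polynomial contains the singlet of each bond, which is
orthogonal to the maximal-spin states (`sum_star_mul_vbs_eq_zero`).

The two phases of the cycle give two limits. With `N` the number of vertices in layer one, the ratio
of the probabilities of the two extreme spin values at the root is `r ^ N` in one and `r ^ (-N)` in
the other. -/

namespace AKLT

/-! ### Parents, children and layers of the rooted tree. -/

section Tree

variable {V : Type*} {G : SimpleGraph V} {o : V}

theorem mem_ball_iff [G.LocallyFinite] (hG : G.IsTree) {n : ℕ} {x : V} :
    x ∈ ball G o n ↔ G.dist o x ≤ n := by
  rw [ball, Set.Finite.mem_toFinset, Set.mem_ofPred_eq,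
    ← (hG.1.preconnected o x).coe_dist_eq_edist]
  exact Nat.cast_le

theorem mem_layer_iff [G.LocallyFinite] (hG : G.IsTree) {n : ℕ} {x : V} :
    x ∈ layer G o n ↔ G.dist o x = n := by
  rw [layer, Set.Finite.mem_toFinset, Set.mem_ofPred_eq,
    ← (hG.1.preconnected o x).coe_dist_eq_edist]
  exact Nat.cast_inj

theorem layer_subset_ball [G.LocallyFinite] (hG : G.IsTree) (n : ℕ) :
    layer G o n ⊆ ball G o n :=
  fun _ hx => (mem_ball_iff hG).2 ((mem_layer_iff hG).1 hx).le

theorem exists_isEdge_of_dist_eq (hG : G.IsTree) {n : ℕ} {y : V} (hy : G.dist o y = n + 1) :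
    ∃ x, IsEdge G o x y := by
  obtain ⟨p, hp⟩ := hG.1.exists_walk_length_eq_dist y o
  cases p with
  | nil => simp at hy
  | @cons _ x _ h q =>
    refine ⟨x, h.symm, ?_⟩
    have h1 : G.dist o x ≤ n := by
      rw [SimpleGraph.dist_comm]
      refine (SimpleGraph.dist_le q).trans ?_
      rw [SimpleGraph.dist_comm, hy] at hp
      simpa using hp.le
    have := hG.dist_eq_dist_add_one_of_adj o h
    omega

/-- Going to `x` (or `x'`) and then along a geodesic to the root has length equal to the distance,
hence is a path; paths in a tree are unique. -/
theorem IsEdge.eq (hG : G.IsTree) {x x' y : V} (h : IsEdge G o x y) (h' : IsEdge G o x' y) :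
    x = x' := by
  have key : ∀ x, IsEdge G o x y → ∃ p : G.Walk y o, p.IsPath ∧ p.snd = x := by
    rintro x ⟨hadj, hd⟩
    obtain ⟨p, hp⟩ := hG.1.exists_walk_length_eq_dist x o
    refine ⟨SimpleGraph.Walk.cons hadj.symm p, ?_, by simp⟩
    apply SimpleGraph.Walk.isPath_of_length_eq_dist
    rw [SimpleGraph.Walk.length_cons, hp, SimpleGraph.dist_comm, SimpleGraph.dist_comm (u := y), hd]
  obtain ⟨p, hp, rfl⟩ := key x h
  obtain ⟨q, hq, rfl⟩ := key x' h'
  rw [(hG.existsUnique_path y o).unique hp hq]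

variable [G.LocallyFinite]

theorem exists_parent (hG : G.IsTree) (n : ℕ) (y : layer G o (n + 1)) :
    ∃ x : layer G o n, IsEdge G o x y := by
  have hy := (mem_layer_iff hG).1 y.2
  obtain ⟨x, hx⟩ := exists_isEdge_of_dist_eq hG hy
  refine ⟨⟨x, (mem_layer_iff hG).2 ?_⟩, hx⟩
  have := hx.2
  omega

/-- The neighbour of a vertex of layer `n + 1` in layer `n`. -/
noncomputable def parent (hG : G.IsTree) (n : ℕ) (y : layer G o (n + 1)) : layer G o n :=
  (exists_parent hG n y).choose

theorem isEdge_parent (hG : G.IsTree) {n : ℕ} (y : layer G o (n + 1)) :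
    IsEdge G o (parent hG n y) y := (exists_parent hG n y).choose_spec

theorem isEdge_iff_eq_parent (hG : G.IsTree) {n : ℕ} {x : V} (y : layer G o (n + 1)) :
    IsEdge G o x y ↔ x = parent hG n y :=
  ⟨fun h => h.eq hG (isEdge_parent hG y), fun h => h ▸ isEdge_parent hG y⟩

theorem card_fiber_parent_zero [DecidableEq V] {d : ℕ} (hG : G.IsTree)
    (hdeg : G.IsRegularOfDegree d) (x : layer G o 0) :
    Fintype.card {y // parent hG 0 y = x} = d := by
  have hx : o = (x : V) := by
    have := (mem_layer_iff hG).1 x.2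
    exact (hG.1.dist_eq_zero_iff).1 this
  rw [← hdeg x, ← SimpleGraph.card_neighborFinset_eq_degree, ← Fintype.card_coe]
  refine Fintype.card_congr ((Equiv.subtypeSubtypeEquivSubtypeExists _ _).trans
    (Equiv.subtypeEquivRight fun y => ?_))
  rw [SimpleGraph.mem_neighborFinset]
  constructor
  · rintro ⟨h, rfl⟩
    exact (isEdge_parent hG _).1
  · intro h
    have hy : IsEdge G o x y := ⟨h, by
      rw [← hx] at h ⊢; rw [SimpleGraph.dist_eq_one_iff_adj.2 h, SimpleGraph.dist_self]⟩
    have hm : y ∈ layer G o (0 + 1) := (mem_layer_iff hG).2 (by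
      rw [hy.2, (mem_layer_iff hG).1 x.2])
    exact ⟨hm, Subtype.ext ((isEdge_iff_eq_parent hG ⟨y, hm⟩).1 hy).symm⟩

/-- Away from the root one of the `d` neighbours is the parent, and the others are children. At the
root all `d` neighbours are children. -/
theorem card_fiber_parent_succ [DecidableEq V] {d n : ℕ} (hG : G.IsTree)
    (hdeg : G.IsRegularOfDegree d) (x : layer G o (n + 1)) :
    Fintype.card {y // parent hG (n + 1) y = x} + 1 = d := by
  rw [← hdeg x, ← SimpleGraph.card_neighborFinset_eq_degree,
    ← Finset.card_erase_add_one (s := G.neighborFinset x) (a := parent hG n x)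
      ((G.mem_neighborFinset _ _).2 (isEdge_parent hG x).1.symm), ← Fintype.card_coe]
  congr 1
  refine Fintype.card_congr ((Equiv.subtypeSubtypeEquivSubtypeExists _ _).trans
    (Equiv.subtypeEquivRight fun y => ?_))
  rw [Finset.mem_erase, SimpleGraph.mem_neighborFinset]
  have hxn := (mem_layer_iff hG).1 x.2
  constructor
  · rintro ⟨h, rfl⟩
    refine ⟨?_, (isEdge_parent hG _).1⟩
    intro he
    have h1 := (mem_layer_iff hG).1 h
    have h2 := (mem_layer_iff hG).1 (parent hG n (parent hG (n + 1) ⟨_, h⟩)).2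
    rw [← he, h1] at h2
    omega
  · rintro ⟨hne, h⟩
    have hy : IsEdge G o x y := by
      refine ⟨h, ?_⟩
      rcases hG.dist_eq_dist_add_one_of_adj o h with h' | h'
      · exact absurd ((isEdge_iff_eq_parent hG x).1 ⟨h.symm, h'⟩) hne
      · exact h'
    have hm : y ∈ layer G o (n + 1 + 1) := (mem_layer_iff hG).2 (by rw [hy.2, hxn])
    exact ⟨hm, Subtype.ext ((isEdge_iff_eq_parent hG ⟨y, hm⟩).1 hy).symm⟩

theorem ball_zero_eq_layer (hG : G.IsTree) : ball G o 0 = layer G o 0 := by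
  ext x; rw [mem_ball_iff hG, mem_layer_iff hG]; omega

theorem mem_ball_succ_iff (hG : G.IsTree) {n : ℕ} {x : V} :
    x ∈ ball G o (n + 1) ↔ x ∈ ball G o n ∨ x ∈ layer G o (n + 1) := by
  rw [mem_ball_iff hG, mem_ball_iff hG, mem_layer_iff hG]; omega

theorem disjoint_ball_layer (hG : G.IsTree) (n : ℕ) :
    Disjoint (ball G o n) (layer G o (n + 1)) := by
  rw [Finset.disjoint_left]
  intro x
  rw [mem_ball_iff hG, mem_layer_iff hG]; omega

theorem ball_ne_layer {n : ℕ} (hG : G.IsTree) (x : ball G o n) (y : layer G o (n + 1)) : (x : V) ≠ y :=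
  fun h => Finset.disjoint_left.1 (disjoint_ball_layer hG n) x.2 (h ▸ y.2)

theorem layer_ne_layer_succ {n : ℕ} (hG : G.IsTree) (x : layer G o n) (y : layer G o (n + 1)) :
    (x : V) ≠ y :=
  ball_ne_layer hG ⟨x, layer_subset_ball hG n x.2⟩ y

end Tree

/-! ### Monomial expansion of the valence bond polynomial, layer by layer. -/

section Polynomial

open MvPolynomial

/-- `τ y` chooses the term of the singlet at the edge above `y`: the value `0` takes `u_p v_c`, the
value `1` takes `-v_p u_c`. So the parent receives variable `τ y` and the child the opposite one,
which matches `1` meaning spin up at the child. -/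
theorem prod_singlet_eq_sum {V κ : Type*} [Fintype κ] [DecidableEq κ] (p c : κ → V) :
    (∏ y, (X (p y, 0) * X (c y, 1) - X (p y, 1) * X (c y, 0)) : MvPolynomial (V × Fin 2) ℂ) =
      ∑ τ : κ → Fin 2, monomial (∑ y, (Finsupp.single (p y, τ y) 1
        + Finsupp.single (c y, 1 - τ y) 1)) (∏ y, (-1 : ℂ) ^ (τ y : ℕ)) := by
  have h : ∀ y, (X (p y, 0) * X (c y, 1) - X (p y, 1) * X (c y, 0) : MvPolynomial (V × Fin 2) ℂ) =
      ∑ i : Fin 2, monomial (Finsupp.single (p y, i) 1 + Finsupp.single (c y, 1 - i) 1)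
        ((-1 : ℂ) ^ (i : ℕ)) := by
    intro y
    simp [Fin.sum_univ_two, X, monomial_mul, sub_eq_add_neg]
  simp_rw [h]
  rw [Finset.prod_univ_sum, Fintype.piFinset_univ]
  exact Finset.sum_congr rfl fun τ _ => (monomial_sum_prod _ _ _).symm

variable {V : Type*} {G : SimpleGraph V} [G.LocallyFinite] {o : V} {d n : ℕ}

theorem exponents_apply_of_notMem (hG : G.IsTree) (s : Config G o d n) (τ : BdryConfig G o n)
    {v : V} (hv : v ∉ ball G o (n + 1)) (i : Fin 2) : exponents G o s τ (v, i) = 0 := by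
  rw [mem_ball_succ_iff hG, not_or] at hv
  have h1 : ∀ x : ball G o n, (x : V) ≠ v := fun x h => hv.1 (h ▸ x.2)
  have h2 : ∀ x : layer G o (n + 1), (x : V) ≠ v := fun x h => hv.2 (h ▸ x.2)
  simp [exponents, h1, h2]

/-- The exponents of the term of `∏ (u_x v_y - v_x u_y)`, over the edges between the layers `n` and
`n + 1`, in which the variables of layer `n + 1` occur according to `τ`. -/
noncomputable def edgeExponents (hG : G.IsTree) (τ : BdryConfig G o n) : V × Fin 2 →₀ ℕ :=
  ∑ y, (Finsupp.single ((parent hG n y : V), τ y) 1 + Finsupp.single ((y : V), 1 - τ y) 1)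

theorem edgeExponents_apply_of_notMem (hG : G.IsTree) (τ : BdryConfig G o n) {v : V}
    (hv : v ∉ layer G o n) (hv' : v ∉ layer G o (n + 1)) (i : Fin 2) :
    edgeExponents hG τ (v, i) = 0 := by
  have h1 : ∀ x : layer G o n, (x : V) ≠ v := fun x h => hv (h ▸ x.2)
  have h2 : ∀ x : layer G o (n + 1), (x : V) ≠ v := fun x h => hv' (h ▸ x.2)
  simp [edgeExponents, h1, h2]

/-- The product of the singlets over the edges between the layers `n` and `n + 1`. -/
noncomputable def layerPoly (hG : G.IsTree) (o : V) (n : ℕ) : MvPolynomial (V × Fin 2) ℂ :=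
  ∏ y : layer G o (n + 1), (X ((parent hG n y : V), 0) * X ((y : V), 1)
    - X ((parent hG n y : V), 1) * X ((y : V), 0))

theorem prod_layer_eq_layerPoly (hG : G.IsTree) (o : V) (n : ℕ) :
    (open Classical in
    ∏ x ∈ layer G o n, ∏ y ∈ ball G o (n + 1), if IsEdge G o x y then
      MvPolynomial.X (x, 0) * MvPolynomial.X (y, 1) - MvPolynomial.X (x, 1) * MvPolynomial.X (y, 0)
    else (1 : MvPolynomial (V × Fin 2) ℂ)) = layerPoly hG o n := by
  classical
  rw [Finset.prod_comm, layerPoly, Finset.prod_coe_sort_eq_attach,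
    ← Finset.prod_subset (fun y hy => (mem_ball_succ_iff hG).2 (Or.inr hy)), ← Finset.prod_attach]
  · refine Finset.prod_congr rfl fun y _ => ?_
    rw [Finset.prod_eq_single (parent hG n y : V), if_pos (isEdge_parent hG y)]
    · intro x _ hx
      rw [if_neg (fun h => hx ((isEdge_iff_eq_parent hG y).1 h))]
    · exact fun h => absurd (parent hG n y).2 h
  · intro y _ hy
    refine Finset.prod_eq_one fun x hx => if_neg fun h => hy ?_
    rw [mem_layer_iff hG] at hx ⊢
    rw [h.2, hx]

theorem vbsPoly_zero (hG : G.IsTree) : vbsPoly G o 0 = layerPoly hG o 0 := by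
  rw [vbsPoly, ← prod_layer_eq_layerPoly, ball_zero_eq_layer hG]

theorem vbsPoly_succ (hG : G.IsTree) :
    vbsPoly G o (n + 1) = vbsPoly G o n * layerPoly hG o (n + 1) := by
  classical
  have hu : ∀ n, ball G o (n + 1) = ball G o n ∪ layer G o (n + 1) := fun n => by
    ext x; rw [mem_ball_succ_iff hG, Finset.mem_union]
  rw [vbsPoly, vbsPoly, hu n, Finset.prod_union (disjoint_ball_layer hG n), ← hu n,
    prod_layer_eq_layerPoly hG]
  congr 1
  refine Finset.prod_congr rfl fun x hx => ?_
  rw [hu (n + 1), Finset.prod_union (disjoint_ball_layer hG _)]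
  rw [Finset.prod_eq_one (s := layer G o _), mul_one]
  refine fun y hy => if_neg fun h => ?_
  rw [mem_ball_iff hG] at hx
  rw [mem_layer_iff hG, h.2] at hy
  omega

variable [DecidableEq V]

theorem exponents_apply_ball_zero (hG : G.IsTree) (s : Config G o d n) (τ : BdryConfig G o n)
    (x : ball G o n) : exponents G o s τ (x, 0) = s x := by
  simp [exponents, Finsupp.single_apply, (ball_ne_layer hG _ _).symm]

theorem exponents_apply_ball_one (hG : G.IsTree) (s : Config G o d n) (τ : BdryConfig G o n)
    (x : ball G o n) : exponents G o s τ (x, 1) = d - s x := by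
  simp only [exponents, Finsupp.add_apply, Finsupp.finsetSum_apply, Finsupp.single_apply,
    Prod.mk.injEq, (ball_ne_layer hG _ _).symm]
  rw [Finset.sum_eq_single x] <;> simp +contextual

theorem exponents_apply_layer (hG : G.IsTree) (s : Config G o d n) (τ : BdryConfig G o n)
    (y : layer G o (n + 1)) (i : Fin 2) :
    exponents G o s τ (y, i) = if i = 1 - τ y then 1 else 0 := by
  simp only [exponents, Finsupp.add_apply, Finsupp.finsetSum_apply, Finsupp.single_apply,
    Prod.mk.injEq, ball_ne_layer hG _ _]
  rw [Finset.sum_eq_single y (by simp +contextual) (by simp)]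
  generalize τ y = j
  fin_cases i <;> fin_cases j <;> simp

/-- The number of children of `x` with boundary spin `i`. -/
noncomputable def childCount (hG : G.IsTree) (τ : BdryConfig G o n) (x : layer G o n)
    (i : Fin 2) : ℕ := (Finset.univ.filter fun y => parent hG n y = x ∧ τ y = i).card

theorem childCount_zero_add_one (hG : G.IsTree) (τ : BdryConfig G o n) (x : layer G o n) :
    childCount hG τ x 0 + childCount hG τ x 1 = Fintype.card {y // parent hG n y = x} := by
  rw [childCount, childCount, ← Finset.card_union_of_disjoint, Fintype.card_subtype]
  · congr 1
    ext y
    simp only [Finset.mem_union, Finset.mem_filter, Finset.mem_univ, true_and, ← and_or_left]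
    refine and_iff_left ?_
    generalize τ y = j
    fin_cases j <;> simp
  · rw [Finset.disjoint_filter]
    rintro y - ⟨-, h⟩ ⟨-, h'⟩
    simp [h] at h'

theorem edgeExponents_apply_layer (hG : G.IsTree) (τ : BdryConfig G o n) (x : layer G o n)
    (i : Fin 2) : edgeExponents hG τ (x, i) = childCount hG τ x i := by
  simp [edgeExponents, childCount, Finsupp.single_apply, (layer_ne_layer_succ hG _ _).symm]

theorem edgeExponents_apply_layer_succ (hG : G.IsTree) (τ : BdryConfig G o n)
    (y : layer G o (n + 1)) (i : Fin 2) :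
    edgeExponents hG τ (y, i) = if i = 1 - τ y then 1 else 0 := by
  simp only [edgeExponents, Finsupp.finsetSum_apply, Finsupp.add_apply, Finsupp.single_apply,
    Prod.mk.injEq, layer_ne_layer_succ hG _ _]
  rw [Finset.sum_eq_single y (by simp +contextual) (by simp)]
  simp [eq_comm]

theorem layerPoly_eq_sum (hG : G.IsTree) (o : V) (n : ℕ) : layerPoly hG o n =
    ∑ τ : BdryConfig G o n, monomial (edgeExponents hG τ) (∏ y, (-1 : ℂ) ^ (τ y : ℕ)) :=
  prod_singlet_eq_sum _ _

end Polynomial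

/-! ### The recursion for the matrix elements of the valence bond map. -/

section Recursion

open MvPolynomial

variable {V : Type*} {G : SimpleGraph V} [G.LocallyFinite] {o : V} {d n : ℕ}

open Classical in
/-- The decomposition of `T_{n+1}` into `T_n` and layer `n + 1`. -/
noncomputable def ballSuccEquiv (hG : G.IsTree) (o : V) (n : ℕ) :
    ball G o n ⊕ layer G o (n + 1) ≃ ball G o (n + 1) :=
  (Equiv.Finset.union _ _ (disjoint_ball_layer hG n)).trans
    (Equiv.subtypeEquivRight fun _ => by rw [Finset.mem_union, mem_ball_succ_iff hG])

@[simp]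
theorem ballSuccEquiv_inl (hG : G.IsTree) (x : ball G o n) :
    (ballSuccEquiv hG o n (Sum.inl x) : V) = x := rfl

@[simp]
theorem ballSuccEquiv_inr (hG : G.IsTree) (x : layer G o (n + 1)) :
    (ballSuccEquiv hG o n (Sum.inr x) : V) = x := rfl

/-- Configurations of `T_{n+1}` as pairs of configurations of `T_n` and of layer `n + 1`. -/
noncomputable def configSuccEquiv (hG : G.IsTree) (o : V) (d n : ℕ) :
    Config G o d n × (layer G o (n + 1) → Fin (d + 1)) ≃ Config G o d (n + 1) :=
  (Equiv.sumArrowEquivProdArrow _ _ _).symm.trans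
    (Equiv.arrowCongr (ballSuccEquiv hG o n) (Equiv.refl _))

@[simp]
theorem configSuccEquiv_inl (hG : G.IsTree) (s : Config G o d n)
    (r : layer G o (n + 1) → Fin (d + 1)) (x : ball G o n) :
    configSuccEquiv hG o d n (s, r) (ballSuccEquiv hG o n (Sum.inl x)) = s x := by
  simp [configSuccEquiv, Equiv.arrowCongr]

@[simp]
theorem configSuccEquiv_inr (hG : G.IsTree) (s : Config G o d n)
    (r : layer G o (n + 1) → Fin (d + 1)) (x : layer G o (n + 1)) :
    configSuccEquiv hG o d n (s, r) (ballSuccEquiv hG o n (Sum.inr x)) = r x := by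
  simp [configSuccEquiv, Equiv.arrowCongr]

variable [DecidableEq V]

theorem eq_of_edgeExponents_le (hG : G.IsTree) {s : Config G o d n} {τ τ' : BdryConfig G o n}
    (h : edgeExponents hG τ' ≤ exponents G o s τ) : τ' = τ := by
  funext y
  have := h (y, 1 - τ' y)
  rw [edgeExponents_apply_layer_succ, exponents_apply_layer hG, if_pos rfl] at this
  split_ifs at this with hy
  · exact sub_right_injective hy
  · omega

/-- The exponents at the boundary spins already fix which term of each outer singlet is used, so
only one term of the expansion of `layerPoly` survives. -/
theorem coeff_mul_layerPoly (hG : G.IsTree) (P : MvPolynomial (V × Fin 2) ℂ) (s : Config G o d n)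
    (τ : BdryConfig G o n) :
    coeff (exponents G o s τ) (P * layerPoly hG o n) =
      (∏ y, (-1 : ℂ) ^ (τ y : ℕ)) * if edgeExponents hG τ ≤ exponents G o s τ then
        coeff (exponents G o s τ - edgeExponents hG τ) P else 0 := by
  rw [layerPoly_eq_sum, Finset.mul_sum, coeff_sum, Finset.sum_eq_single τ]
  · rw [coeff_mul_monomial']
    split_ifs <;> ring
  · intro τ' _ hτ
    rw [coeff_mul_monomial', if_neg fun h => hτ (eq_of_edgeExponents_le hG h)]
  · simp

/-- A vertex of layer `n + 1` gets its factors `u` from the edges to its children (`childCount`) and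
from the edge to its parent (`σ x`). The exponent of `v` then agrees as well, since the vertex has
`d - 1` children. -/
theorem exponents_succ_eq_add (hG : G.IsTree) (hdeg : G.IsRegularOfDegree d) {s : Config G o d n}
    {r : layer G o (n + 1) → Fin (d + 1)} {τ : BdryConfig G o (n + 1)} {σ : BdryConfig G o n}
    (h : ∀ x, (r x : ℕ) = childCount hG τ x 0 + σ x) :
    exponents G o (configSuccEquiv hG o d n (s, r)) τ =
      edgeExponents hG τ + exponents G o s σ := by
  ext ⟨v, i⟩
  rw [Finsupp.add_apply]
  by_cases hv : v ∈ ball G o (n + 1)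
  · obtain ⟨x, hx⟩ := (ballSuccEquiv hG o n).surjective ⟨v, hv⟩
    obtain rfl : (ballSuccEquiv hG o n x : V) = v := congrArg Subtype.val hx
    have hi : i = 0 ∨ i = 1 := by omega
    rcases x with x | x
    · rw [edgeExponents_apply_of_notMem hG, zero_add]
      · rcases hi with rfl | rfl
        · rw [exponents_apply_ball_zero hG, configSuccEquiv_inl, ballSuccEquiv_inl,
            exponents_apply_ball_zero hG]
        · rw [exponents_apply_ball_one hG, configSuccEquiv_inl, ballSuccEquiv_inl,
            exponents_apply_ball_one hG]
      · exact fun h => ball_ne_layer hG x ⟨_, h⟩ rfl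
      · intro h
        have h1 := (mem_layer_iff hG).1 h
        have h2 := (mem_ball_iff hG).1 x.2
        simp only [ballSuccEquiv_inl] at h1
        omega
    · have h1 := childCount_zero_add_one hG τ x
      have h2 := card_fiber_parent_succ hG hdeg x
      have h3 := h x
      have h4 : ((1 - σ x : Fin 2) : ℕ) = 1 - (σ x : ℕ) := by
        generalize σ x = j
        fin_cases j <;> rfl
      have h5 := (σ x).isLt
      rcases hi with rfl | rfl
      · rw [exponents_apply_ball_zero hG, configSuccEquiv_inr, ballSuccEquiv_inr,
          edgeExponents_apply_layer, exponents_apply_layer hG, h3]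
        congr 1
        simp only [Fin.ext_iff, h4, Fin.val_zero]
        split_ifs <;> omega
      · rw [exponents_apply_ball_one hG, configSuccEquiv_inr, ballSuccEquiv_inr,
          edgeExponents_apply_layer, exponents_apply_layer hG, h3]
        simp only [Fin.ext_iff, h4, Fin.val_one]
        split_ifs <;> omega
  · rw [exponents_apply_of_notMem hG s σ hv, add_zero]
    by_cases hv' : v ∈ layer G o (n + 1 + 1)
    · rw [exponents_apply_layer hG _ _ ⟨v, hv'⟩, edgeExponents_apply_layer_succ hG _ ⟨v, hv'⟩]
    · rw [exponents_apply_of_notMem hG, edgeExponents_apply_of_notMem hG _ _ hv']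
      · exact fun h => hv ((mem_ball_succ_iff hG).2 (Or.inr h))
      · rw [mem_ball_succ_iff hG]
        tauto

theorem exists_of_edgeExponents_le (hG : G.IsTree) (hdeg : G.IsRegularOfDegree d)
    {s : Config G o d n} {r : layer G o (n + 1) → Fin (d + 1)} {τ : BdryConfig G o (n + 1)}
    (h : edgeExponents hG τ ≤ exponents G o (configSuccEquiv hG o d n (s, r)) τ) :
    ∃ σ : BdryConfig G o n, ∀ x, (r x : ℕ) = childCount hG τ x 0 + σ x := by
  -- The bounds on the exponents of `u` and `v` at `x`, with `d - 1` children, leave only `0` or `1`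
  -- for this difference, so nothing is lost by reducing it modulo `2`.
  refine ⟨fun x => Fin.ofNat 2 (r x - childCount hG τ x 0), fun x => ?_⟩
  have h1 := childCount_zero_add_one hG τ x
  have h2 := card_fiber_parent_succ hG hdeg x
  have h3 := h (x, 0)
  have h4 := h (x, 1)
  rw [edgeExponents_apply_layer, ← ballSuccEquiv_inr hG, exponents_apply_ball_zero hG,
    configSuccEquiv_inr] at h3
  rw [edgeExponents_apply_layer, ← ballSuccEquiv_inr hG, exponents_apply_ball_one hG,
    configSuccEquiv_inr] at h4
  have h5 := (r x).isLt
  rw [Fin.val_ofNat, Nat.mod_eq_of_lt (by omega)]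
  omega

/-- The normalization of the basis vector `√((d + 1) * d.choose j) * u ^ j * v ^ (d - j)`. -/
noncomputable def weylNorm (d j : ℕ) : ℝ := Real.sqrt (((d : ℝ) + 1) * (d.choose j : ℝ))

theorem exponents_zero_eq_iff (hG : G.IsTree) (hdeg : G.IsRegularOfDegree d) (s : Config G o d 0)
    (τ : BdryConfig G o 0) : exponents G o s τ = edgeExponents hG τ ↔ ∀ x : ball G o 0,
      (s x : ℕ) = childCount hG τ ⟨x, ball_zero_eq_layer hG ▸ x.2⟩ 0 := by
  constructor
  · intro h x
    rw [← exponents_apply_ball_zero hG s τ x, h]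
    exact edgeExponents_apply_layer hG τ ⟨x, _⟩ 0
  · intro h
    ext ⟨v, i⟩
    by_cases hv : v ∈ ball G o 0
    · have h0 := edgeExponents_apply_layer hG τ ⟨v, ball_zero_eq_layer hG ▸ hv⟩ i
      have h1 := childCount_zero_add_one hG τ ⟨v, ball_zero_eq_layer hG ▸ hv⟩
      rw [card_fiber_parent_zero hG hdeg] at h1
      have h2 : (s ⟨v, hv⟩ : ℕ) = childCount hG τ ⟨v, ball_zero_eq_layer hG ▸ hv⟩ 0 := h ⟨v, hv⟩
      rw [h0]
      obtain rfl | rfl : i = 0 ∨ i = 1 := by omega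
      · rw [exponents_apply_ball_zero hG s τ ⟨v, hv⟩, h2]
      · rw [exponents_apply_ball_one hG s τ ⟨v, hv⟩, h2]
        omega
    · by_cases hv' : v ∈ layer G o (0 + 1)
      · rw [exponents_apply_layer hG _ _ ⟨v, hv'⟩, edgeExponents_apply_layer_succ hG _ ⟨v, hv'⟩]
      · rw [exponents_apply_of_notMem hG,
          edgeExponents_apply_of_notMem hG _ (ball_zero_eq_layer hG ▸ hv) hv']
        rw [mem_ball_succ_iff hG]
        tauto

theorem vbs_zero (hG : G.IsTree) (hdeg : G.IsRegularOfDegree d) (s : Config G o d 0)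
    (τ : BdryConfig G o 0) :
    vbs G o d 0 s τ = (∏ y, (-1 : ℂ) ^ (τ y : ℕ)) *
      ∏ x : ball G o 0, if (s x : ℕ) = childCount hG τ ⟨x, ball_zero_eq_layer hG ▸ x.2⟩ 0 then
        ((weylNorm d (s x) : ℝ) : ℂ)⁻¹ else 0 := by
  -- For `T_0` the polynomial inside the last layer is `1`: the root has no edge to a parent, hence
  -- no `σ`.
  rw [vbs, Matrix.of_apply, vbsPoly_zero hG, ← one_mul (layerPoly _ _ _), coeff_mul_layerPoly,
    mul_assoc]
  congr 1
  have hs := exponents_zero_eq_iff hG hdeg s τ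
  by_cases h : ∀ x : ball G o 0,
      (s x : ℕ) = childCount hG τ ⟨x, ball_zero_eq_layer hG ▸ x.2⟩ 0
  · rw [Finset.prod_congr rfl fun x _ => if_pos (h x), hs.2 h, if_pos le_rfl, tsub_self,
      coeff_zero_one, one_mul]
    rfl
  · rw [← hs] at h
    have : (if edgeExponents hG τ ≤ exponents G o s τ then
        coeff (exponents G o s τ - edgeExponents hG τ) (1 : MvPolynomial (V × Fin 2) ℂ) else 0)
          = 0 := by
      split_ifs with hle
      · rw [coeff_one, if_neg fun h0 => h ?_]
        exact le_antisymm (tsub_eq_zero_iff_le.1 h0.symm) hle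
      · rfl
    rw [this, zero_mul]
    rw [hs] at h
    push Not at h
    obtain ⟨x, hx⟩ := h
    rw [Finset.prod_eq_zero (Finset.mem_univ x) (if_neg hx)]

theorem vbs_succ (hG : G.IsTree) (hdeg : G.IsRegularOfDegree d) (s : Config G o d n)
    (r : layer G o (n + 1) → Fin (d + 1)) (τ : BdryConfig G o (n + 1)) :
    vbs G o d (n + 1) (configSuccEquiv hG o d n (s, r)) τ =
      (∏ y, (-1 : ℂ) ^ (τ y : ℕ)) * ∑ σ : BdryConfig G o n, vbs G o d n s σ *
        ∏ x, if (r x : ℕ) = childCount hG τ x 0 + σ x then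
          ((weylNorm d (r x) : ℝ) : ℂ)⁻¹ else 0 := by
  rw [vbs, Matrix.of_apply, vbsPoly_succ hG, coeff_mul_layerPoly, mul_assoc]
  congr 1
  by_cases h : ∃ σ : BdryConfig G o n, ∀ x, (r x : ℕ) = childCount hG τ x 0 + σ x
  · obtain ⟨σ, hσ⟩ := h
    rw [exponents_succ_eq_add hG hdeg hσ, if_pos le_self_add, add_tsub_cancel_left,
      Finset.sum_eq_single σ]
    · rw [Finset.prod_congr rfl fun x _ => if_pos (hσ x), vbs, Matrix.of_apply, mul_assoc,
        ← (ballSuccEquiv hG o n).prod_comp, Fintype.prod_sum_type]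
      simp [weylNorm]
    · intro σ' _ hne
      obtain ⟨x, hx⟩ := Function.ne_iff.1 hne
      rw [Finset.prod_eq_zero (Finset.mem_univ x), mul_zero]
      rw [if_neg]
      intro h'
      rw [hσ x] at h'
      exact hx (Fin.ext (by omega))
    · simp
  · rw [if_neg fun h' => h (exists_of_edgeExponents_le hG hdeg h'), zero_mul]
    symm
    refine Finset.sum_eq_zero fun σ _ => ?_
    push Not at h
    obtain ⟨x, hx⟩ := h σ
    rw [Finset.prod_eq_zero (Finset.mem_univ x) (if_neg hx), mul_zero]

end Recursion

/-! ### Tracing out the last layer: the transfer of weights. -/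

section Transfer

theorem sum_prod_fiberwise {ι κ α R : Type*} [Fintype ι] [DecidableEq ι] [Fintype κ]
    [DecidableEq κ] [Fintype α] [CommRing R] (π : κ → ι) (F : ∀ x : ι, ({y // π y = x} → α) → R) :
    ∑ τ : κ → α, ∏ x, F x (fun y => τ y) = ∏ x, ∑ τ : {y // π y = x} → α, F x τ := by
  rw [Finset.prod_univ_sum, Fintype.piFinset_univ]
  refine Fintype.sum_equiv ((Equiv.arrowCongr (Equiv.sigmaFiberEquiv π).symm (Equiv.refl α)).trans
    (Equiv.piCurry (fun _ _ => α))) _ _ fun τ => ?_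
  rfl

theorem sum_fun_fin_two {κ R : Type*} [Fintype κ] [DecidableEq κ] [CommRing R] (b : Fin 2 → R)
    (f : ℕ → R) :
    ∑ τ : κ → Fin 2, (∏ y, b (τ y)) * f (Finset.univ.filter fun y => τ y = 0).card =
      ∑ j ∈ Finset.range (Fintype.card κ + 1),
        ((Fintype.card κ).choose j : R) * (b 0 ^ j * b 1 ^ (Fintype.card κ - j) * f j) := by
  have h := Finset.sum_powerset_apply_card (x := (Finset.univ : Finset κ))
    (fun j => b 0 ^ j * b 1 ^ (Fintype.card κ - j) * f j)
  rw [Finset.powerset_univ] at h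
  simp only [nsmul_eq_mul, Finset.card_univ] at h
  rw [← h]
  refine Finset.sum_bij' (fun τ _ => Finset.univ.filter fun y => τ y = 0)
    (fun s _ y => if y ∈ s then 0 else 1) (by simp) (by simp) ?_ ?_ ?_
  · intro τ _
    funext y
    simp only [Finset.mem_filter, Finset.mem_univ, true_and]
    split_ifs <;> omega
  · intro s _
    ext y
    simp
  · intro τ _
    congr 1
    rw [← Finset.prod_filter_mul_prod_filter_not Finset.univ (fun y => τ y = 0)]
    congr 1
    · rw [Finset.prod_congr rfl (g := fun _ => b 0), Finset.prod_const]
      simp +contextual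
    · rw [Finset.prod_congr rfl (g := fun _ => b 1), Finset.prod_const, ← Finset.compl_filter,
        Finset.card_compl]
      intro y hy
      congr 1
      have := (Finset.mem_filter.1 hy).2
      omega

/-- The weight which a vertex passes to its parent when all its children have the weight `b`. -/
noncomputable def transferWeight (d : ℕ) (b : Fin 2 → ℝ) (i : Fin 2) : ℝ :=
  ∑ j ∈ Finset.range d, ((d - 1).choose j : ℝ) *
    (b 0 ^ j * b 1 ^ (d - 1 - j) * (weylNorm d (j + i) ^ 2)⁻¹)

theorem sum_ite_mul_ite {d z : ℕ} (hz : z + 1 ≤ d) (i i' : Fin 2) :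
    (∑ j : Fin (d + 1), (if (j : ℕ) = z + i then ((weylNorm d j : ℝ) : ℂ)⁻¹ else 0) *
      (if (j : ℕ) = z + i' then ((weylNorm d j : ℝ) : ℂ)⁻¹ else 0)) =
      if i = i' then (((weylNorm d (z + i) ^ 2)⁻¹ : ℝ) : ℂ) else 0 := by
  rw [Finset.sum_eq_single ⟨z + i, by omega⟩]
  · simp only [if_true, Nat.add_left_cancel_iff, ← Fin.ext_iff]
    split_ifs
    · push_cast
      rw [sq, mul_inv]
    · simp
  · intro j _ hj
    rw [if_neg fun h => hj (Fin.ext h), zero_mul]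
  · simp

variable {V : Type*} [DecidableEq V] {G : SimpleGraph V} [G.LocallyFinite] {o : V} {d n : ℕ}

theorem childCount_zero_le (hG : G.IsTree) (hdeg : G.IsRegularOfDegree d)
    (τ : BdryConfig G o (n + 1)) (x : layer G o (n + 1)) : childCount hG τ x 0 + 1 ≤ d := by
  have h1 := childCount_zero_add_one hG τ x
  have h2 := card_fiber_parent_succ hG hdeg x
  omega

theorem childCount_eq_card (hG : G.IsTree) (τ : BdryConfig G o n) (x : layer G o n) (i : Fin 2) :
    childCount hG τ x i =
      (Finset.univ.filter fun y : {y // parent hG n y = x} => τ y = i).card := by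
  refine (congrArg Finset.card ?_).trans (Finset.card_map (Function.Embedding.subtype _))
  ext y
  simp [and_comm]

/-- The kernel is diagonal because `r` and `τ` determine `σ` through `r x = childCount + σ x`. It is
a product because the sums over `r` and over the boundary spins split into independent sums, one for
each vertex `x` with its children. -/
theorem sum_kernel (hG : G.IsTree) (hdeg : G.IsRegularOfDegree d) (b : Fin 2 → ℝ)
    (σ σ' : BdryConfig G o n) :
    (∑ τ : BdryConfig G o (n + 1), (∏ y, (b (τ y) : ℂ)) *
      ∑ r : layer G o (n + 1) → Fin (d + 1),
        (∏ x, if (r x : ℕ) = childCount hG τ x 0 + σ x then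
          ((weylNorm d (r x) : ℝ) : ℂ)⁻¹ else 0) *
        ∏ x, if (r x : ℕ) = childCount hG τ x 0 + σ' x then
          ((weylNorm d (r x) : ℝ) : ℂ)⁻¹ else 0) =
      if σ = σ' then ∏ x, ((transferWeight d b (σ x) : ℝ) : ℂ) else 0 := by
  have h1 : ∀ τ : BdryConfig G o (n + 1), ((∏ y, (b (τ y) : ℂ)) *
      ∑ r : layer G o (n + 1) → Fin (d + 1),
        (∏ x, if (r x : ℕ) = childCount hG τ x 0 + σ x then
          ((weylNorm d (r x) : ℝ) : ℂ)⁻¹ else 0) *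
        ∏ x, if (r x : ℕ) = childCount hG τ x 0 + σ' x then
          ((weylNorm d (r x) : ℝ) : ℂ)⁻¹ else 0) =
      ∏ x, ((∏ y : {y // parent hG (n + 1) y = x}, (b (τ y) : ℂ)) *
        if σ x = σ' x then (((weylNorm d ((Finset.univ.filter
          fun y : {y // parent hG (n + 1) y = x} => τ y = 0).card + σ x) ^ 2)⁻¹ : ℝ) : ℂ)
          else 0) := by
    intro τ
    rw [Finset.prod_mul_distrib, ← Fintype.prod_fiberwise (parent hG (n + 1))]
    congr 1
    simp_rw [← Finset.prod_mul_distrib]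
    rw [← Fintype.piFinset_univ, ← Finset.prod_univ_sum (fun _ => Finset.univ)
      (fun x (j : Fin (d + 1)) => (if (j : ℕ) = childCount hG τ x 0 + σ x then
          ((weylNorm d j : ℝ) : ℂ)⁻¹ else 0) *
        (if (j : ℕ) = childCount hG τ x 0 + σ' x then
          ((weylNorm d j : ℝ) : ℂ)⁻¹ else 0))]
    refine Finset.prod_congr rfl fun x _ => ?_
    rw [sum_ite_mul_ite (childCount_zero_le hG hdeg τ x), childCount_eq_card]
  rw [Finset.sum_congr rfl fun τ _ => h1 τ, sum_prod_fiberwise (parent hG (n + 1))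
    (fun x (τ : {y // parent hG (n + 1) y = x} → Fin 2) => (∏ y, (b (τ y) : ℂ)) *
        if σ x = σ' x then (((weylNorm d ((Finset.univ.filter
          fun y => τ y = 0).card + σ x) ^ 2)⁻¹ : ℝ) : ℂ) else 0)]
  have h2 : ∀ x, (∑ τ : {y // parent hG (n + 1) y = x} → Fin 2, (∏ y, (b (τ y) : ℂ)) *
        if σ x = σ' x then (((weylNorm d ((Finset.univ.filter
          fun y => τ y = 0).card + σ x) ^ 2)⁻¹ : ℝ) : ℂ) else 0) =
      if σ x = σ' x then ((transferWeight d b (σ x) : ℝ) : ℂ) else 0 := by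
    intro x
    split_ifs
    · rw [sum_fun_fin_two (fun i => (b i : ℂ))
        (fun j => (((weylNorm d (j + σ x) ^ 2)⁻¹ : ℝ) : ℂ)), card_fiber_parent_succ hG hdeg,
        transferWeight, Nat.eq_sub_of_add_eq (card_fiber_parent_succ hG hdeg x)]
      push_cast
      rfl
    · simp
  rw [Finset.prod_congr rfl fun x _ => h2 x]
  split_ifs with h
  · subst h; simp
  · obtain ⟨x, hx⟩ := Function.ne_iff.1 h
    rw [Finset.prod_eq_zero (Finset.mem_univ x) (if_neg hx)]

/-- The product boundary condition with weights `b 0`, `b 1` of spin down and up. -/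
noncomputable def bdryProd (G : SimpleGraph V) [G.LocallyFinite] (o : V) (n : ℕ)
    (b : Fin 2 → ℝ) : Matrix (BdryConfig G o n) (BdryConfig G o n) ℂ :=
  Matrix.diagonal fun τ => ∏ y, (b (τ y) : ℂ)

/-- The operator `ψ_n B ψ_n*` for the product boundary condition `B` with weights `b`. -/
noncomputable def unnormalized (G : SimpleGraph V) [G.LocallyFinite] (o : V) (d n : ℕ)
    (b : Fin 2 → ℝ) : Obs G o d n :=
  vbs G o d n * bdryProd G o n b * (vbs G o d n).conjTranspose

theorem unnormalized_apply (b : Fin 2 → ℝ) (s t : Config G o d n) :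
    unnormalized G o d n b s t =
      ∑ τ, (∏ y, (b (τ y) : ℂ)) * (vbs G o d n s τ * star (vbs G o d n t τ)) := by
  rw [unnormalized, Matrix.mul_apply]
  refine Finset.sum_congr rfl fun τ _ => ?_
  rw [bdryProd, Matrix.mul_diagonal, Matrix.conjTranspose_apply]
  ring

theorem sum_unnormalized_succ (hG : G.IsTree) (hdeg : G.IsRegularOfDegree d) (b : Fin 2 → ℝ)
    (s t : Config G o d n) :
    ∑ r, unnormalized G o d (n + 1) b (configSuccEquiv hG o d n (s, r))
        (configSuccEquiv hG o d n (t, r)) =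
      unnormalized G o d n (transferWeight d b) s t := by
  have h1 : ∀ (τ : BdryConfig G o (n + 1)) r,
      (∏ y, (b (τ y) : ℂ)) * (vbs G o d (n + 1) (configSuccEquiv hG o d n (s, r)) τ *
        star (vbs G o d (n + 1) (configSuccEquiv hG o d n (t, r)) τ)) =
      ∑ σ, ∑ σ', (vbs G o d n s σ * star (vbs G o d n t σ')) * ((∏ y, (b (τ y) : ℂ)) *
        ((∏ x, if (r x : ℕ) = childCount hG τ x 0 + σ x then
          ((weylNorm d (r x) : ℝ) : ℂ)⁻¹ else 0) *
        ∏ x, if (r x : ℕ) = childCount hG τ x 0 + σ' x then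
          ((weylNorm d (r x) : ℝ) : ℂ)⁻¹ else 0)) := by
    intro τ r
    -- As `B` is diagonal, both factors carry the same `τ`, so the signs of the singlets cancel.
    have hs : (∏ y, (-1 : ℂ) ^ (τ y : ℕ)) * (∏ y, (-1 : ℂ) ^ (τ y : ℕ)) = 1 := by
      rw [← Finset.prod_mul_distrib]
      exact Finset.prod_eq_one fun y _ => by rw [← mul_pow]; simp
    rw [vbs_succ hG hdeg, vbs_succ hG hdeg]
    simp only [star_mul', star_sum, star_prod, star_pow, star_neg, star_one, apply_ite star,
      star_inv₀, star_zero, Complex.star_def, Complex.conj_ofReal]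
    rw [mul_mul_mul_comm, hs, one_mul, Finset.sum_mul_sum, Finset.mul_sum]
    refine Finset.sum_congr rfl fun σ _ => ?_
    rw [Finset.mul_sum]
    refine Finset.sum_congr rfl fun σ' _ => ?_
    ring
  simp_rw [unnormalized_apply, h1]
  rw [Finset.sum_comm]
  calc _ = ∑ σ, ∑ σ', (vbs G o d n s σ * star (vbs G o d n t σ')) *
        (∑ τ : BdryConfig G o (n + 1), (∏ y, (b (τ y) : ℂ)) *
      ∑ r : layer G o (n + 1) → Fin (d + 1),
        (∏ x, if (r x : ℕ) = childCount hG τ x 0 + σ x then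
          ((weylNorm d (r x) : ℝ) : ℂ)⁻¹ else 0) *
        ∏ x, if (r x : ℕ) = childCount hG τ x 0 + σ' x then
          ((weylNorm d (r x) : ℝ) : ℂ)⁻¹ else 0) := by
        simp_rw [Finset.mul_sum]
        rw [Finset.sum_congr rfl fun τ _ => Finset.sum_comm, Finset.sum_comm]
        refine Finset.sum_congr rfl fun σ _ => ?_
        rw [Finset.sum_congr rfl fun τ _ => Finset.sum_comm, Finset.sum_comm]
    _ = _ := by
        refine Finset.sum_congr rfl fun σ _ => ?_
        simp_rw [sum_kernel hG hdeg]
        simp [mul_comm]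

end Transfer

/-! ### The two-cycle of the weight map. -/

section Weights

theorem weylNorm_sq (d j : ℕ) : weylNorm d j ^ 2 = ((d : ℝ) + 1) * (d.choose j : ℝ) :=
  Real.sq_sqrt (by positivity)

theorem transferWeight_zero (m : ℕ) (b : Fin 2 → ℝ) :
    transferWeight (m + 1) b 0 = (((m : ℝ) + 1) * (m + 2))⁻¹ *
      ∑ j ∈ Finset.range (m + 1), ((m : ℝ) + 1 - j) * (b 0 ^ j * b 1 ^ (m - j)) := by
  rw [transferWeight, Finset.mul_sum]
  refine Finset.sum_congr rfl fun j hj => ?_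
  have hj' : j ≤ m := by simpa [Nat.lt_succ_iff] using hj
  have h := Nat.choose_mul_succ_eq m j
  have hp : (0 : ℝ) < (m + 1).choose j := by exact_mod_cast Nat.choose_pos (by omega)
  have h' : (m.choose j : ℝ) * (m + 1) = (m + 1).choose j * (m + 1 - j) := by
    rw [← Nat.cast_add_one, ← Nat.cast_sub (by omega)]
    exact_mod_cast h
  rw [weylNorm_sq, Nat.add_sub_cancel]
  simp only [Fin.val_zero, add_zero]
  push_cast
  field_simp
  linear_combination (b 0 ^ j * b 1 ^ (m - j) * (m + 2)) * h'

theorem transferWeight_one (m : ℕ) (b : Fin 2 → ℝ) :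
    transferWeight (m + 1) b 1 = (((m : ℝ) + 1) * (m + 2))⁻¹ *
      ∑ j ∈ Finset.range (m + 1), ((j : ℝ) + 1) * (b 0 ^ j * b 1 ^ (m - j)) := by
  rw [transferWeight, Finset.mul_sum]
  refine Finset.sum_congr rfl fun j hj => ?_
  have hj' : j ≤ m := by simpa [Nat.lt_succ_iff] using hj
  have h := Nat.add_one_mul_choose_eq m j
  have hp : (0 : ℝ) < (m + 1).choose (j + 1) := by exact_mod_cast Nat.choose_pos (by omega)
  have h' : ((m : ℝ) + 1) * m.choose j = (m + 1).choose (j + 1) * (j + 1) := by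
    exact_mod_cast h
  rw [weylNorm_sq, Nat.add_sub_cancel]
  simp only [Fin.val_one]
  push_cast
  field_simp
  linear_combination (b 0 ^ j * b 1 ^ (m - j) * (m + 2)) * h'

theorem sum_geom_half (m : ℕ) :
    ∑ j ∈ Finset.range (m + 1), (((m : ℝ) + 1 - j) * (1 / 2) ^ (j + 1) - (j + 1) * (1 / 2) ^ j) =
      (m : ℝ) - 4 + (m + 7 / 2) * (1 / 2) ^ m := by
  -- The `m + 1` in the summand is freed to a parameter `a`, so that the induction changes only the
  -- range of summation.
  have h : ∀ a : ℝ, ∀ m : ℕ,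
      ∑ j ∈ Finset.range (m + 1), ((a - j) * (1 / 2) ^ (j + 1) - (j + 1) * (1 / 2 : ℝ) ^ j) =
      a - 5 + (5 / 2 - a / 2 + 3 / 2 * (m + 1)) * (1 / 2) ^ m := by
    intro a m
    induction m with
    | zero => norm_num; ring
    | succ m ih =>
      rw [Finset.sum_range_succ, ih]
      push_cast
      ring
  rw [h]
  ring

/-- The two-periodic point of the transfer of weights which exists for `d ≥ 5`. -/
theorem exists_weight_ratio {m : ℕ} (hm : 4 ≤ m) : ∃ r : ℝ, 0 < r ∧ r < 1 ∧
    r * ∑ j ∈ Finset.range (m + 1), ((m : ℝ) + 1 - j) * r ^ j =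
      ∑ j ∈ Finset.range (m + 1), ((j : ℝ) + 1) * r ^ j := by
  let f : ℝ → ℝ := fun r =>
    ∑ j ∈ Finset.range (m + 1), (((m : ℝ) + 1 - j) * r ^ (j + 1) - (j + 1) * r ^ j)
  have hf : Continuous f := by fun_prop
  have h0 : f 0 < 0 := by
    simp [f, Finset.sum_range_succ']
  -- The value `f 1 = 0` belongs to the uniform fixed point, so the zero must be sought strictly
  -- below `1`. At `1 / 2` the closed form is `m - 4` plus a positive term, and `m ≥ 4` is exactly
  -- `d ≥ 5`.
  have h1 : 0 < f (1 / 2) := by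
    have : (4 : ℝ) ≤ m := by exact_mod_cast hm
    have hp : (0 : ℝ) < (m + 7 / 2) * (1 / 2) ^ m := by positivity
    simp only [f]
    rw [sum_geom_half]
    linarith
  obtain ⟨r, ⟨hr0, hr1⟩, hr⟩ := intermediate_value_Ioo (by norm_num) hf.continuousOn ⟨h0, h1⟩
  refine ⟨r, hr0, by linarith, ?_⟩
  rw [Finset.mul_sum, ← sub_eq_zero, ← Finset.sum_sub_distrib, ← hr]
  refine Finset.sum_congr rfl fun j _ => ?_
  ring

/-- The weights of the spin down and up states in the `k`-th layer of the Néel ordered states. -/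
noncomputable def neelWeight (r : ℝ) (k : ℕ) : Fin 2 → ℝ := if Even k then ![r, 1] else ![1, r]

/-- The single equation for `r` handles both parities: exchanging up and down amounts to reversing
the sums, `j ↦ m - j`, which is `hrefl` below. The constant `c` is the transferred weight that must
become `1`. -/
theorem exists_neelWeight {d : ℕ} (hd : 5 ≤ d) : ∃ r c : ℝ, 0 < r ∧ r < 1 ∧ 0 < c ∧
    ∀ k, transferWeight d (neelWeight r (k + 1)) = c • neelWeight r k := by
  obtain ⟨m, rfl⟩ : ∃ m, d = m + 1 := ⟨d - 1, by omega⟩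
  obtain ⟨r, h0, h1, hr⟩ := exists_weight_ratio (m := m) (by omega)
  refine ⟨r, (((m : ℝ) + 1) * (m + 2))⁻¹ * ∑ j ∈ Finset.range (m + 1), ((m : ℝ) + 1 - j) * r ^ j,
    h0, h1, ?_, fun k => ?_⟩
  · refine mul_pos (by positivity) (Finset.sum_pos (fun j hj => ?_) ⟨0, by simp⟩)
    have : (j : ℝ) < m + 1 := by exact_mod_cast Finset.mem_range.1 hj
    have : (0 : ℝ) < m + 1 - j := by linarith
    positivity
  · have hrefl : ∀ g : ℕ → ℝ → ℝ, ∑ j ∈ Finset.range (m + 1), g j (r ^ (m - j)) =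
        ∑ j ∈ Finset.range (m + 1), g (m - j) (r ^ j) := fun g => by
      rw [← Finset.sum_range_reflect]
      refine Finset.sum_congr rfl fun j hj => ?_
      have : j ≤ m := by simpa [Nat.lt_succ_iff] using hj
      simp only [Nat.add_sub_cancel]
      congr 2
      omega
    rcases Nat.even_or_odd k with hk | hk
    · have hk' : ¬ Even (k + 1) := by simpa [Nat.even_add_one] using hk
      ext i
      rw [neelWeight, if_neg hk', neelWeight, if_pos hk]
      obtain rfl | rfl : i = 0 ∨ i = 1 := by omega
      · rw [transferWeight_zero]
        simp only [Matrix.cons_val_zero, Matrix.cons_val_one, one_pow, one_mul, Pi.smul_apply,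
          smul_eq_mul]
        rw [hrefl (fun j x => ((m : ℝ) + 1 - j) * x), mul_assoc, mul_comm _ r, hr]
        congr 1
        refine Finset.sum_congr rfl fun j hj => ?_
        rw [Nat.cast_sub (by simpa [Nat.lt_succ_iff] using hj)]
        ring
      · rw [transferWeight_one]
        simp only [Matrix.cons_val_zero, Matrix.cons_val_one, one_pow, one_mul, Pi.smul_apply,
          smul_eq_mul, mul_one]
        rw [hrefl (fun j x => ((j : ℝ) + 1) * x)]
        congr 1
        refine Finset.sum_congr rfl fun j hj => ?_
        rw [Nat.cast_sub (by simpa [Nat.lt_succ_iff] using hj)]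
        ring
    · have hk' : Even (k + 1) := by simpa [Nat.even_add_one] using hk
      ext i
      rw [neelWeight, if_pos hk', neelWeight, if_neg (Nat.not_even_iff_odd.2 hk)]
      obtain rfl | rfl : i = 0 ∨ i = 1 := by omega
      · rw [transferWeight_zero]
        simp
      · rw [transferWeight_one]
        simp only [Matrix.cons_val_zero, Matrix.cons_val_one, one_pow, mul_one, Pi.smul_apply,
          smul_eq_mul]
        rw [mul_assoc, mul_comm _ r, hr]

end Weights

/-! ### Density matrices define functionals of norm at most one. -/

open scoped MatrixOrder Matrix.Norms.L2Operator in
theorem exists_eq_conjTranspose_mul_self {ι : Type*} [Fintype ι] [DecidableEq ι]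
    {ρ : Matrix ι ι ℂ} (hρ : ρ.PosSemidef) : ∃ C : Matrix ι ι ℂ, ρ = C.conjTranspose * C :=
  CStarAlgebra.nonneg_iff_eq_star_mul_self.mp hρ.nonneg

theorem norm_trace_mul_le_of_posSemidef {ι : Type*} [Fintype ι] [DecidableEq ι]
    {ρ : Matrix ι ι ℂ} (hρ : ρ.PosSemidef) (h1 : ρ.trace = 1) (A : Matrix ι ι ℂ) :
    ‖(ρ * A).trace‖ ≤ ‖Matrix.toEuclideanCLM (𝕜 := ℂ) A‖ := by
  obtain ⟨C, rfl⟩ := exists_eq_conjTranspose_mul_self hρ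
  -- The conjugated rows of `C` decompose `ρ` as `∑ |c i⟩⟨c i|`. Taking `A = 1` below gives `∑ ‖c
  -- i‖² = 1`.
  let c : ι → EuclideanSpace ℂ ι := fun i => WithLp.toLp 2 (star (C i))
  have hA : ∀ A : Matrix ι ι ℂ, (C.conjTranspose * C * A).trace =
      ∑ i, inner ℂ (c i) (Matrix.toEuclideanCLM (𝕜 := ℂ) A (c i)) := by
    intro A
    rw [mul_assoc, Matrix.trace_mul_comm, mul_assoc, Matrix.trace]
    refine Finset.sum_congr rfl fun i _ => ?_
    simp only [c, Matrix.toEuclideanCLM_toLp, EuclideanSpace.inner_toLp_toLp, star_star]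
    rw [dotProduct_comm]
    rfl
  have h2 : ∑ i, ‖c i‖ ^ 2 = 1 := by
    have := hA 1
    rw [mul_one, h1] at this
    simp only [map_one, one_apply_eq_self, inner_self_eq_norm_sq_to_K] at this
    exact Complex.ofReal_injective (by simpa using this.symm)
  calc _ ≤ ∑ i, ‖c i‖ * (‖Matrix.toEuclideanCLM (𝕜 := ℂ) A‖ * ‖c i‖) := by
        rw [hA]
        refine norm_sum_le_of_le _ fun i _ => (norm_inner_le_norm _ _).trans ?_
        gcongr
        exact ContinuousLinearMap.le_opNorm _ _
    _ = ‖Matrix.toEuclideanCLM (𝕜 := ℂ) A‖ * ∑ i, ‖c i‖ ^ 2 := by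
        rw [Finset.mul_sum]
        exact Finset.sum_congr rfl fun i _ => by ring
    _ = _ := by rw [h2, mul_one]

/-! ### Spin operators and the total spin of a bond. -/

section Energy

variable {V : Type*} [DecidableEq V] {G : SimpleGraph V} [G.LocallyFinite] {o : V} {d n : ℕ}

theorem siteOp_mulVec (x : ball G o n) (M : Matrix (Fin (d + 1)) (Fin (d + 1)) ℂ)
    (w : Config G o d n → ℂ) (s : Config G o d n) :
    (siteOp G o x M).mulVec w s = ∑ k, M (s x) k * w (Function.update s x k) := by
  rw [Matrix.mulVec, dotProduct]
  symm
  refine Finset.sum_of_injOn (fun k => Function.update s x k) ?_ (by simp) ?_ ?_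
  · intro k _ k' _ h
    simpa using congrFun h x
  · intro t _ ht
    rw [siteOp, Matrix.of_apply, if_neg, zero_mul]
    intro h
    refine ht ⟨t x, by simp, ?_⟩
    ext z
    by_cases hz : z = x
    · subst hz; simp
    · simp [hz, h z hz]
  · intro k _
    rw [siteOp, Matrix.of_apply, if_pos]
    · simp
    · intro z hz
      simp [hz]

theorem siteOp_mul (x : ball G o n) (M N : Matrix (Fin (d + 1)) (Fin (d + 1)) ℂ) :
    siteOp G o x M * siteOp G o x N = siteOp G o x (M * N) := by
  refine Matrix.ext_of_mulVec_single fun t => ?_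
  ext s
  rw [← Matrix.mulVec_mulVec, siteOp_mulVec, siteOp_mulVec]
  simp_rw [siteOp_mulVec, Finset.mul_sum, Matrix.mul_apply, Finset.sum_mul]
  rw [Finset.sum_comm]
  simp [mul_assoc]

/-- This is `SˣS'ˣ + SʸS'ʸ = (S⁺S'⁻ + S⁻S'⁺) / 2` without commutation assumptions, so that it serves
both for the Casimir operator of one site and for the coupling of two sites. -/
theorem spin_pair_identity {R : Type*} [Ring R] [Algebra ℂ R] (P Q P' Q' : R) :
    ((1 / 2 : ℂ) • (P + Q)) * ((1 / 2 : ℂ) • (P' + Q')) +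
      ((1 / (2 * Complex.I) : ℂ) • (P - Q)) * ((1 / (2 * Complex.I) : ℂ) • (P' - Q')) =
      (1 / 2 : ℂ) • (P * Q' + Q * P') := by
  have h : (1 / (2 * Complex.I)) * (1 / (2 * Complex.I)) = -(1 / 4) := by
    field_simp
    norm_num
  rw [smul_mul_smul_comm, smul_mul_smul_comm, h, mul_add, add_mul, add_mul, mul_sub, sub_mul,
    sub_mul]
  module

theorem sq_add_of_commute {R : Type*} [Ring R] [Algebra ℂ R] {a b : R} (h : a * b = b * a) :
    (a + b) ^ 2 = a * a + b * b + (2 : ℂ) • (a * b) := by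
  rw [sq, add_mul, mul_add, mul_add, ← h, two_smul]
  abel

theorem smul_add_smul_add_two_smul {M : Type*} [AddCommGroup M] [Module ℂ M] (c : ℂ) (e p q : M) :
    (c / 2 * (c / 2 + 1)) • e + (c / 2 * (c / 2 + 1)) • e + (2 : ℂ) • ((1 / 2 : ℂ) • p + q) =
      (c * (c / 2 + 1)) • e + (p + (2 : ℂ) • q) := by
  module

theorem sum_spinPlus_mul (i : Fin (d + 1)) (f : ℕ → ℂ) :
    ∑ k : Fin (d + 1), spinPlus d i k * f k =
      ((Real.sqrt (((d : ℝ) + 1 - i) * i) : ℝ) : ℂ) * f (i - 1) := by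
  rcases Nat.eq_zero_or_pos (i : ℕ) with hi | hi
  · rw [Finset.sum_eq_zero]
    · simp [hi]
    · intro k _
      simp [spinPlus, hi]
  · have hi' := i.isLt
    rw [Finset.sum_eq_single ⟨i - 1, by omega⟩]
    · rw [spinPlus, Matrix.of_apply, if_pos (by simp only; omega)]
      simp only [Nat.cast_pred hi]
      congr 4 <;> ring
    · intro k _ hk
      rw [spinPlus, Matrix.of_apply, if_neg, zero_mul]
      intro h
      exact hk (Fin.ext (by simp only; omega))
    · simp

theorem sum_spinPlus_conjTranspose_mul (i : Fin (d + 1)) (f : ℕ → ℂ) :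
    ∑ k : Fin (d + 1), (spinPlus d).conjTranspose i k * f k =
      ((Real.sqrt (((d : ℝ) - i) * (i + 1)) : ℝ) : ℂ) * f (i + 1) := by
  have hi := i.isLt
  rcases Nat.lt_or_ge (i : ℕ) d with hi' | hi'
  · rw [Finset.sum_eq_single ⟨i + 1, by omega⟩]
    · simp [spinPlus]
    · intro k _ hk
      rw [Matrix.conjTranspose_apply, spinPlus, Matrix.of_apply, if_neg, star_zero, zero_mul]
      intro h
      exact hk (Fin.ext h)
    · simp
  · have : (i : ℕ) = d := by omega
    rw [Finset.sum_eq_zero]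
    · simp [this]
    · intro k _
      have := k.isLt
      rw [Matrix.conjTranspose_apply, spinPlus, Matrix.of_apply, if_neg (by omega), star_zero,
        zero_mul]

theorem sum_spin_mul_self (d : ℕ) : ∑ a, spin d a * spin d a =
    ((d : ℂ) / 2 * ((d : ℂ) / 2 + 1)) • (1 : Matrix (Fin (d + 1)) (Fin (d + 1)) ℂ) := by
  have hs : ∀ z : ℝ, 0 ≤ z → ((Real.sqrt z : ℝ) : ℂ) * ((Real.sqrt z : ℝ) : ℂ) = z := fun z hz => by
    rw [← Complex.ofReal_mul, Real.mul_self_sqrt hz]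
  have hP : spinPlus d * (spinPlus d).conjTranspose =
      Matrix.diagonal fun j : Fin (d + 1) => ((d : ℂ) + 1 - (j : ℕ)) * (j : ℕ) := by
    ext i j
    have hij := i.isLt
    have h := sum_spinPlus_mul i fun k =>
      if (j : ℕ) = k + 1 then ((Real.sqrt (((d : ℝ) - k) * (k + 1)) : ℝ) : ℂ) else 0
    rw [Matrix.mul_apply]
    simp only [Matrix.conjTranspose_apply, spinPlus, Matrix.of_apply, apply_ite star,
      Complex.star_def, Complex.conj_ofReal, map_zero] at h ⊢
    rw [h, Matrix.diagonal_apply]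
    rcases Nat.eq_zero_or_pos (i : ℕ) with hi | hi
    · simp [hi]
    · have hle : (i : ℝ) ≤ d := by exact_mod_cast Nat.lt_succ_iff.1 i.isLt
      rw [Nat.sub_add_cancel hi, Nat.cast_pred hi, sub_add_cancel, sub_sub_eq_add_sub]
      by_cases hj : i = j
      · rw [if_pos hj, if_pos (by rw [hj]), hs _ (mul_nonneg (by linarith) (by positivity))]
        push_cast
        ring
      · rw [if_neg hj, if_neg fun h => hj (Fin.ext h.symm), mul_zero]
  have hQ : (spinPlus d).conjTranspose * spinPlus d =
      Matrix.diagonal fun j : Fin (d + 1) => ((d : ℂ) - (j : ℕ)) * ((j : ℕ) + 1) := by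
    ext i j
    have h := sum_spinPlus_conjTranspose_mul i fun k =>
      if k = (j : ℕ) + 1 then ((Real.sqrt (((d : ℝ) - (j : ℕ)) * ((j : ℕ) + 1)) : ℝ) : ℂ) else 0
    rw [Matrix.mul_apply]
    rw [Matrix.diagonal_apply]
    refine h.trans ?_
    have hle : (i : ℝ) ≤ d := by exact_mod_cast Nat.lt_succ_iff.1 i.isLt
    by_cases hj : i = j
    · subst hj
      rw [if_pos rfl, if_pos rfl, hs _ (mul_nonneg (by linarith) (by positivity))]
      push_cast
      ring
    · rw [if_neg hj, if_neg fun h => hj (Fin.ext (by omega)), mul_zero]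
  rw [Fin.sum_univ_three]
  simp only [spin, Matrix.cons_val_zero, Matrix.cons_val_one, Matrix.cons_val]
  rw [spin_pair_identity, hP, hQ, Matrix.diagonal_mul_diagonal, Matrix.diagonal_add,
    ← Matrix.diagonal_smul, Matrix.diagonal_add, ← Matrix.diagonal_one, ← Matrix.diagonal_smul]
  congr 1
  ext j
  simp only [Pi.smul_apply, smul_eq_mul]
  ring

theorem siteOp_add (x : ball G o n) (M N : Matrix (Fin (d + 1)) (Fin (d + 1)) ℂ) :
    siteOp G o x (M + N) = siteOp G o x M + siteOp G o x N := by
  ext s t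
  simp only [siteOp, Matrix.of_apply, Matrix.add_apply]
  split_ifs <;> simp

theorem siteOp_smul (x : ball G o n) (c : ℂ) (M : Matrix (Fin (d + 1)) (Fin (d + 1)) ℂ) :
    siteOp G o x (c • M) = c • siteOp G o x M := by
  ext s t
  simp [siteOp, Matrix.of_apply, Matrix.smul_apply]

theorem siteOp_one (x : ball G o n) :
    siteOp G o x (1 : Matrix (Fin (d + 1)) (Fin (d + 1)) ℂ) = 1 := by
  refine Matrix.ext_of_mulVec_single fun t => ?_
  ext s
  rw [siteOp_mulVec, Finset.sum_eq_single (s x)]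
  · simp [Matrix.one_apply, Pi.single_apply]
  · intro k _ hk
    rw [Matrix.one_apply_ne hk.symm, zero_mul]
  · simp

theorem siteOp_mulVec_siteOp_mulVec {x y : ball G o n} (hxy : x ≠ y)
    (M N : Matrix (Fin (d + 1)) (Fin (d + 1)) ℂ) (w : Config G o d n → ℂ) (s : Config G o d n) :
    (siteOp G o x M * siteOp G o y N).mulVec w s =
      ∑ k, M (s x) k * ∑ l, N (s y) l * w (Function.update (Function.update s x k) y l) := by
  rw [← Matrix.mulVec_mulVec, siteOp_mulVec]
  simp_rw [siteOp_mulVec, Function.update_of_ne hxy.symm]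

theorem siteOp_commute {x y : ball G o n} (hxy : x ≠ y)
    (M N : Matrix (Fin (d + 1)) (Fin (d + 1)) ℂ) :
    siteOp G o x M * siteOp G o y N = siteOp G o y N * siteOp G o x M := by
  refine Matrix.ext_of_mulVec_single fun t => ?_
  ext s
  rw [siteOp_mulVec_siteOp_mulVec hxy, siteOp_mulVec_siteOp_mulVec hxy.symm]
  simp_rw [Finset.mul_sum, Function.update_comm hxy]
  rw [Finset.sum_comm]
  refine Finset.sum_congr rfl fun k _ => Finset.sum_congr rfl fun l _ => ?_
  ring

/-- Expand `(S_x + S_y)² = S_x² + S_y² + 2 S_x · S_y`; both squares are the Casimir scalar `d/2 (d/2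
+ 1)`. -/
theorem totalSpinSq_eq {x y : ball G o n} (hxy : x ≠ y) :
    totalSpinSq (d := d) G o x y = ((d : ℂ) * ((d : ℂ) / 2 + 1)) • 1 +
      (siteOp G o x (spinPlus d) * siteOp G o y (spinPlus d).conjTranspose +
        siteOp G o x (spinPlus d).conjTranspose * siteOp G o y (spinPlus d) +
        (2 : ℂ) • (siteOp G o x (spin d 2) * siteOp G o y (spin d 2))) := by
  have h1 : ∀ z : ball G o n, ∑ a, siteOp G o z (spin d a) * siteOp G o z (spin d a) =
      ((d : ℂ) / 2 * ((d : ℂ) / 2 + 1)) • 1 := fun z => by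
    have h := congrArg (siteOp G o z) (sum_spin_mul_self d)
    rw [siteOp_smul, siteOp_one] at h
    rw [← h]
    simp only [Fin.sum_univ_three, siteOp_add, siteOp_mul]
  have hX : ∀ z : ball G o n, siteOp G o z (spin d 0) =
      (1 / 2 : ℂ) • (siteOp G o z (spinPlus d) + siteOp G o z (spinPlus d).conjTranspose) :=
    fun z => by rw [← siteOp_add, ← siteOp_smul]; rfl
  have hY : ∀ z : ball G o n, siteOp G o z (spin d 1) = (1 / (2 * Complex.I) : ℂ) •
      (siteOp G o z (spinPlus d) - siteOp G o z (spinPlus d).conjTranspose) := fun z => by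
    rw [eq_comm, sub_eq_iff_eq_add.2 (by rw [← siteOp_add, sub_add_cancel] :
      siteOp G o z (spinPlus d) = siteOp G o z (spinPlus d - (spinPlus d).conjTranspose) +
        siteOp G o z (spinPlus d).conjTranspose), ← siteOp_smul]
    rfl
  have h2 : ∑ a, siteOp G o x (spin d a) * siteOp G o y (spin d a) =
      (1 / 2 : ℂ) • (siteOp G o x (spinPlus d) * siteOp G o y (spinPlus d).conjTranspose +
        siteOp G o x (spinPlus d).conjTranspose * siteOp G o y (spinPlus d)) +
        (siteOp G o x (spin d 2) * siteOp G o y (spin d 2)) := by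
    rw [Fin.sum_univ_three, hX, hX, hY, hY, spin_pair_identity]
  have h3 : totalSpinSq (d := d) G o x y =
      ∑ a, siteOp G o x (spin d a) * siteOp G o x (spin d a) +
      ∑ a, siteOp G o y (spin d a) * siteOp G o y (spin d a) +
      (2 : ℂ) • ∑ a, siteOp G o x (spin d a) * siteOp G o y (spin d a) := by
    rw [totalSpinSq, Finset.smul_sum, ← Finset.sum_add_distrib, ← Finset.sum_add_distrib]
    refine Finset.sum_congr rfl fun a _ => ?_
    exact sq_add_of_commute (siteOp_commute hxy _ _)
  rw [h3, h1, h1, h2]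
  exact smul_add_smul_add_two_smul _ _ _ _

end Energy

/-! ### Maximal-spin states of a bond as zero modes of a hopping operator. -/

theorem weylNorm_pos {d j : ℕ} (hj : j ≤ d) : 0 < weylNorm d j :=
  Real.sqrt_pos.2 (mul_pos (by positivity) (by exact_mod_cast Nat.choose_pos hj))

/-- Dividing coordinates by `weylNorm` removes the square roots: the ladder operators then have the
integer coefficients `i` and `d - i`. -/
theorem sqrt_mul_weylNorm_pred {d i : ℕ} (hi : i ≤ d) :
    Real.sqrt (((d : ℝ) + 1 - i) * i) * weylNorm d (i - 1) = i * weylNorm d i := by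
  rcases Nat.eq_zero_or_pos i with rfl | h0
  · simp
  have hi' : (i : ℝ) ≤ d := by exact_mod_cast hi
  obtain ⟨k, rfl⟩ : ∃ k, i = k + 1 := ⟨i - 1, by omega⟩
  have h : (d.choose (k + 1) : ℝ) * (k + 1) = d.choose k * (d - k) := by
    have := Nat.choose_succ_right_eq d k
    rw [← Nat.cast_sub (by omega)]
    exact_mod_cast this
  refine (pow_left_inj₀ (by unfold weylNorm; positivity) (by unfold weylNorm; positivity)
    two_ne_zero).1 ?_
  rw [mul_pow, mul_pow, Real.sq_sqrt (mul_nonneg (by linarith) (by positivity)), weylNorm_sq,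
    weylNorm_sq]
  push_cast
  linear_combination (-(d : ℝ) - 1) * (k + 1) * h

theorem sqrt_mul_weylNorm_succ {d i : ℕ} (hi : i ≤ d) :
    Real.sqrt (((d : ℝ) - i) * (i + 1)) * weylNorm d (i + 1) = (d - i) * weylNorm d i := by
  have hi' : (i : ℝ) ≤ d := by exact_mod_cast hi
  have h : (d.choose (i + 1) : ℝ) * (i + 1) = d.choose i * (d - i) := by
    have := Nat.choose_succ_right_eq d i
    rw [← Nat.cast_sub (by omega)]
    exact_mod_cast this
  refine (pow_left_inj₀ (by unfold weylNorm; positivity)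
    (mul_nonneg (by linarith) (by unfold weylNorm; positivity)) two_ne_zero).1 ?_
  rw [mul_pow, mul_pow, Real.sq_sqrt (mul_nonneg (by linarith) (by positivity)), weylNorm_sq,
    weylNorm_sq]
  linear_combination ((d : ℝ) + 1) * (d - i) * h

/-- A zero mode of the ferromagnetic hopping generator is invariant under hopping. -/
theorem eq_of_hopping_eq_zero {d : ℕ} (a : ℕ → ℕ → ℂ)
    (h : ∀ i ≤ d, ∀ j ≤ d, (i : ℂ) * (d - j) * (a (i - 1) (j + 1) - a i j) +
      (d - i) * j * (a (i + 1) (j - 1) - a i j) = 0) :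
    ∀ i < d, ∀ j ≤ d, 0 < j → a (i + 1) (j - 1) = a i j := by
  intro i
  -- At `i = 0` the first term of the equation is absent. For `i + 1` it vanishes by the previous
  -- step, or through the factor `d - j` when `j = d`; in both cases the second term alone is zero.
  induction i with
  | zero =>
    intro hd j hj hj0
    have := h 0 (Nat.zero_le _) j hj
    have hd' : (d : ℂ) ≠ 0 := by exact_mod_cast hd.ne'
    have hj' : (j : ℂ) ≠ 0 := by exact_mod_cast hj0.ne'
    simpa [hd', hj', sub_eq_zero] using this
  | succ i ih =>
    intro hi j hj hj0
    have h1 := h (i + 1) hi.le j hj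
    have h2 : ((d : ℂ) - j) * (a i (j + 1) - a (i + 1) j) = 0 := by
      rcases hj.eq_or_lt with rfl | hlt
      · simp
      · have := ih (by omega) (j + 1) hlt (by omega)
        rw [Nat.add_sub_cancel] at this
        rw [this, sub_self, mul_zero]
    have hd' : (d : ℂ) - ((i + 1 : ℕ) : ℂ) ≠ 0 := by
      rw [sub_ne_zero]
      exact_mod_cast hi.ne'
    have hj' : (j : ℂ) ≠ 0 := by exact_mod_cast hj0.ne'
    rw [Nat.add_sub_cancel, mul_assoc, h2, mul_zero, zero_add] at h1
    exact sub_eq_zero.1 ((mul_eq_zero.1 h1).resolve_left (mul_ne_zero hd' hj'))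

section Energy

variable {V : Type*} [DecidableEq V] {G : SimpleGraph V} [G.LocallyFinite] {o : V} {d n : ℕ}

/-- In coordinates divided by the norms, the eigenvalue equation for `d (d + 1)` becomes the hopping
equation of `eq_of_hopping_eq_zero`, since its diagonal part is `d (k + l) - 2 k l = k (d - l) + (d
- k) l`. -/
theorem hop_eq_of_totalSpinSq_mulVec {x y : ball G o n} (hxy : x ≠ y) {w : Config G o d n → ℂ}
    (hw : (totalSpinSq G o x y).mulVec w = ((d : ℂ) * ((d : ℂ) + 1)) • w) (s : Config G o d n)
    {i j : Fin (d + 1)} (hi : (i : ℕ) = s x + 1) (hj : (s y : ℕ) = j + 1) :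
    w (Function.update (Function.update s x i) y j) * ((weylNorm d i * weylNorm d j : ℝ) : ℂ)⁻¹ =
      w s * ((weylNorm d (s x) * weylNorm d (s y) : ℝ) : ℂ)⁻¹ := by
  -- Indices outside `0, …, d` wrap around or truncate, but these values always occur with a
  -- vanishing coefficient.
  let F : ℕ → ℕ → ℂ := fun k l =>
    w (Function.update (Function.update s x (Fin.ofNat (d + 1) k)) y (Fin.ofNat (d + 1) l))
  let a : ℕ → ℕ → ℂ := fun k l => F k l * ((weylNorm d k * weylNorm d l : ℝ) : ℂ)⁻¹
  have hF : ∀ k l : Fin (d + 1), F k l = w (Function.update (Function.update s x k) y l) := by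
    intro k l
    simp only [F]
    congr <;> exact Fin.ext (by simp)
  have key : ∀ k ≤ d, ∀ l ≤ d,
      ((Real.sqrt (((d : ℝ) + 1 - k) * k) : ℝ) : ℂ) *
        (((Real.sqrt (((d : ℝ) - l) * (l + 1)) : ℝ) : ℂ) * F (k - 1) (l + 1)) +
      ((Real.sqrt (((d : ℝ) - k) * (k + 1)) : ℝ) : ℂ) *
        (((Real.sqrt (((d : ℝ) + 1 - l) * l) : ℝ) : ℂ) * F (k + 1) (l - 1)) +
      2 * (((k : ℂ) - d / 2) * ((l : ℂ) - d / 2)) * F k l = (d : ℂ) ^ 2 / 2 * F k l := by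
    intro k hk l hl
    let k' : Fin (d + 1) := ⟨k, by omega⟩
    let l' : Fin (d + 1) := ⟨l, by omega⟩
    have h := congrFun hw (Function.update (Function.update s x k') y l')
    have hu : ∀ k₁ l₁ : Fin (d + 1), Function.update (Function.update (Function.update
        (Function.update s x k') y l') x k₁) y l₁ =
        Function.update (Function.update s x k₁) y l₁ := fun k₁ l₁ => by
      rw [Function.update_comm hxy, Function.update_idem, Function.update_comm hxy.symm,
        Function.update_idem]
    rw [totalSpinSq_eq hxy, Matrix.add_mulVec, Matrix.add_mulVec, Matrix.add_mulVec,
      Matrix.smul_mulVec, Matrix.smul_mulVec, Matrix.one_mulVec] at h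
    simp only [Pi.add_apply, Pi.smul_apply, siteOp_mulVec_siteOp_mulVec hxy, hu, smul_eq_mul,
      Function.update_self, Function.update_of_ne hxy, ← hF] at h
    have hz : ∀ (m : Fin (d + 1)) (f : ℕ → ℂ),
        ∑ p : Fin (d + 1), spin d 2 m p * f p = ((m : ℂ) - d / 2) * f m := fun m f => by
      simp [spin, Matrix.diagonal_apply]
    have e1 := fun k₁ : ℕ => sum_spinPlus_conjTranspose_mul l' (F k₁)
    have e2 := fun k₁ : ℕ => sum_spinPlus_mul l' (F k₁)
    have e3 := fun k₁ : ℕ => hz l' (F k₁)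
    simp only [e1, e2, e3] at h
    rw [sum_spinPlus_mul k' fun k₁ => ((Real.sqrt (((d : ℝ) - l') * (l' + 1)) : ℝ) : ℂ) *
        F k₁ (l' + 1), sum_spinPlus_conjTranspose_mul k' fun k₁ =>
        ((Real.sqrt (((d : ℝ) + 1 - l') * l') : ℝ) : ℂ) * F k₁ (l' - 1),
      hz k' fun k₁ => ((l' : ℂ) - d / 2) * F k₁ l'] at h
    simp only [k', l'] at h
    linear_combination h
  have hN : ∀ k ≤ d, (weylNorm d k : ℂ) ≠ 0 := fun k hk => by
    exact_mod_cast (weylNorm_pos hk).ne'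
  have hFa : ∀ k ≤ d, ∀ l ≤ d, F k l = weylNorm d k * weylNorm d l * a k l := by
    intro k hk l hl
    have := hN k hk
    have := hN l hl
    simp only [a]
    push_cast
    field_simp
  have hsymm := eq_of_hopping_eq_zero a (d := d) fun k hk l hl => by
    have h := key k hk l hl
    have p1 : ((Real.sqrt (((d : ℝ) + 1 - k) * k) : ℝ) : ℂ) *
        (((Real.sqrt (((d : ℝ) - l) * (l + 1)) : ℝ) : ℂ) * F (k - 1) (l + 1)) =
        weylNorm d k * weylNorm d l * (k * (d - l) * a (k - 1) (l + 1)) := by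
      have q1 : ((Real.sqrt (((d : ℝ) + 1 - k) * k) : ℝ) : ℂ) * weylNorm d (k - 1) =
        k * weylNorm d k := by exact_mod_cast sqrt_mul_weylNorm_pred hk
      have q2 : ((Real.sqrt (((d : ℝ) - l) * (l + 1)) : ℝ) : ℂ) * weylNorm d (l + 1) =
        (d - l) * weylNorm d l := by exact_mod_cast sqrt_mul_weylNorm_succ hl
      rcases hl.eq_or_lt with rfl | hlt
      · simp
      · rw [hFa _ (by omega) _ hlt]
        linear_combination (((Real.sqrt (((d : ℝ) - l) * (l + 1)) : ℝ) : ℂ) * weylNorm d (l + 1) *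
          a (k - 1) (l + 1)) * q1 + (k * weylNorm d k * a (k - 1) (l + 1)) * q2
    have p2 : ((Real.sqrt (((d : ℝ) - k) * (k + 1)) : ℝ) : ℂ) *
        (((Real.sqrt (((d : ℝ) + 1 - l) * l) : ℝ) : ℂ) * F (k + 1) (l - 1)) =
        weylNorm d k * weylNorm d l * ((d - k) * l * a (k + 1) (l - 1)) := by
      have q1 : ((Real.sqrt (((d : ℝ) + 1 - l) * l) : ℝ) : ℂ) * weylNorm d (l - 1) =
        l * weylNorm d l := by exact_mod_cast sqrt_mul_weylNorm_pred hl
      have q2 : ((Real.sqrt (((d : ℝ) - k) * (k + 1)) : ℝ) : ℂ) * weylNorm d (k + 1) =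
        (d - k) * weylNorm d k := by exact_mod_cast sqrt_mul_weylNorm_succ hk
      rcases hk.eq_or_lt with rfl | hlt
      · simp
      · rw [hFa _ hlt _ (by omega)]
        linear_combination (((Real.sqrt (((d : ℝ) - k) * (k + 1)) : ℝ) : ℂ) * weylNorm d (k + 1) *
          a (k + 1) (l - 1)) * q1 + (l * weylNorm d l * a (k + 1) (l - 1)) * q2
    rw [p1, p2, hFa k hk l hl] at h
    refine (mul_eq_zero.1 ?_).resolve_left (mul_ne_zero (hN k hk) (hN l hl))
    linear_combination h
  have hs := hsymm (s x) (by omega) (s y) (by omega) (by omega)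
  rw [← hi, hj, Nat.add_sub_cancel] at hs
  simp only [a] at hs
  rw [← hj, hF, hF] at hs
  simpa using hs

end Energy

/-! ### Valence bond states have zero energy. -/

theorem single_add_single_le_iff {α : Type*} {p q : α} (hpq : p ≠ q) (E : α →₀ ℕ) :
    Finsupp.single p 1 + Finsupp.single q 1 ≤ E ↔ 1 ≤ E p ∧ 1 ≤ E q := by
  classical
  constructor
  · intro h
    have h1 := h p
    have h2 := h q
    simp only [Finsupp.add_apply, Finsupp.single_apply, hpq, hpq.symm, if_true, if_false] at h1 h2
    omega
  · rintro ⟨h1, h2⟩ r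
    simp only [Finsupp.add_apply, Finsupp.single_apply]
    split_ifs <;> simp_all

section Energy

variable {V : Type*} {G : SimpleGraph V} [G.LocallyFinite] {o : V} {d n : ℕ}

theorem exists_vbsPoly_eq_mul {x y : ball G o n} (hxy : IsEdge G o x y) :
    ∃ Q, vbsPoly G o n = (MvPolynomial.X ((x : V), 0) * MvPolynomial.X ((y : V), 1) -
      MvPolynomial.X ((x : V), 1) * MvPolynomial.X ((y : V), 0)) * Q := by
  classical
  have h1 := Finset.dvd_prod_of_mem (fun y' : V => if IsEdge G o x y' then
    (MvPolynomial.X ((x : V), 0) * MvPolynomial.X (y', 1) -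
      MvPolynomial.X ((x : V), 1) * MvPolynomial.X (y', 0) : MvPolynomial (V × Fin 2) ℂ) else 1)
    (ball_mono G o n.le_succ y.2)
  have h2 := Finset.dvd_prod_of_mem (fun x' => ∏ y' ∈ ball G o (n + 1), if IsEdge G o x' y' then
    (MvPolynomial.X (x', 0) * MvPolynomial.X (y', 1) -
      MvPolynomial.X (x', 1) * MvPolynomial.X (y', 0) : MvPolynomial (V × Fin 2) ℂ) else 1) x.2
  simp only [if_pos hxy] at h1
  exact h1.trans h2

variable [DecidableEq V]

theorem exponents_hop (hG : G.IsTree) {x y : ball G o n} (hxy : x ≠ y) {s t : Config G o d n}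
    (hx : (t x : ℕ) = s x + 1) (hy : (s y : ℕ) = t y + 1) (hst : ∀ z, z ≠ x → z ≠ y → s z = t z)
    (τ : BdryConfig G o n) :
    exponents G o t τ + (Finsupp.single ((x : V), 1) 1 + Finsupp.single ((y : V), 0) 1) =
      exponents G o s τ + (Finsupp.single ((x : V), 0) 1 + Finsupp.single ((y : V), 1) 1) := by
  have hxy' : (x : V) ≠ y := fun h => hxy (Subtype.ext h)
  have hsy := (s y).isLt
  have htx := (t x).isLt
  ext ⟨v, i⟩
  simp only [Finsupp.add_apply, Finsupp.single_apply, Prod.mk.injEq]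
  by_cases hv : v ∈ ball G o n
  · obtain ⟨z, rfl⟩ : ∃ z : ball G o n, (z : V) = v := ⟨⟨v, hv⟩, rfl⟩
    simp only [Subtype.coe_inj]
    obtain rfl | rfl : i = 0 ∨ i = 1 := by omega
    · rw [exponents_apply_ball_zero hG, exponents_apply_ball_zero hG]
      by_cases hzx : x = z
      · subst hzx; simp [hxy.symm, hx]
      · by_cases hzy : y = z
        · subst hzy; simp [hxy, hy]
        · simp [hzx, hzy, hst z (Ne.symm hzx) (Ne.symm hzy)]
    · rw [exponents_apply_ball_one hG, exponents_apply_ball_one hG]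
      by_cases hzx : x = z
      · subst hzx; simp [hxy.symm, hx]; omega
      · by_cases hzy : y = z
        · subst hzy; simp [hxy, hy]; omega
        · simp [hzx, hzy, hst z (Ne.symm hzx) (Ne.symm hzy)]
  · have h1 : (x : V) ≠ v := fun h => hv (h ▸ x.2)
    have h2 : (y : V) ≠ v := fun h => hv (h ▸ y.2)
    simp only [h1, h2, false_and, if_false, add_zero]
    by_cases hv' : v ∈ layer G o (n + 1)
    · rw [exponents_apply_layer hG _ _ ⟨v, hv'⟩, exponents_apply_layer hG _ _ ⟨v, hv'⟩]
    · have : v ∉ ball G o (n + 1) := by rw [mem_ball_succ_iff hG]; tauto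
      rw [exponents_apply_of_notMem hG _ _ this, exponents_apply_of_notMem hG _ _ this]

/-- The configuration in which one unit of spin is moved from `y` to `x`. -/
def hop (x y : ball G o n) (s : Config G o d n) : Config G o d n :=
  Function.update (Function.update s x (Fin.ofNat (d + 1) (s x + 1))) y
    (Fin.ofNat (d + 1) (s y - 1))

theorem hop_apply_left {x y : ball G o n} (hxy : x ≠ y) {s : Config G o d n}
    (hx : (s x : ℕ) < d) : (hop x y s x : ℕ) = s x + 1 := by
  rw [hop, Function.update_of_ne hxy, Function.update_self, Fin.val_ofNat,
    Nat.mod_eq_of_lt (by omega)]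

theorem hop_apply_right (x y : ball G o n) (s : Config G o d n) :
    (hop x y s y : ℕ) = s y - 1 := by
  rw [hop, Function.update_self, Fin.val_ofNat, Nat.mod_eq_of_lt (by omega)]

theorem hop_apply_of_ne {x y z : ball G o n} (hx : z ≠ x) (hy : z ≠ y) (s : Config G o d n) :
    hop x y s z = s z := by
  rw [hop, Function.update_of_ne hy, Function.update_of_ne hx]

theorem hop_hop {x y : ball G o n} (hxy : x ≠ y) {s : Config G o d n}
    (hx : (s x : ℕ) < d) (hy : 0 < (s y : ℕ)) : hop y x (hop x y s) = s := by
  have h1 := hop_apply_left hxy hx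
  have h2 := hop_apply_right x y s
  have h3 := (s y).isLt
  funext z
  by_cases hzx : z = x
  · subst hzx
    refine Fin.ext ?_
    rw [hop_apply_right]; omega
  · by_cases hzy : z = y
    · subst hzy
      refine Fin.ext ?_
      rw [hop_apply_left hxy.symm (by omega)]; omega
    · rw [hop_apply_of_ne hzy hzx, hop_apply_of_ne hzx hzy]

/-- The two terms of the singlet cancel: the `u_x v_y` term at `s` and the `v_x u_y` term at `hop y
x s` pick the same coefficient of `Q`, and `g` agrees on these two configurations. -/
theorem sum_mul_coeff_singlet_mul_eq_zero (hG : G.IsTree) {x y : ball G o n} (hxy : x ≠ y)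
    (g : Config G o d n → ℂ)
    (hg : ∀ s : Config G o d n, (s x : ℕ) < d → 0 < (s y : ℕ) → g (hop x y s) = g s)
    (Q : MvPolynomial (V × Fin 2) ℂ) (τ : BdryConfig G o n) :
    ∑ s, g s * MvPolynomial.coeff (exponents G o s τ)
      ((MvPolynomial.X ((x : V), 0) * MvPolynomial.X ((y : V), 1) -
        MvPolynomial.X ((x : V), 1) * MvPolynomial.X ((y : V), 0)) * Q) = 0 := by
  have hxy' : (x : V) ≠ y := fun h => hxy (Subtype.ext h)
  have hm : ∀ i j : Fin 2, (MvPolynomial.X ((x : V), i) * MvPolynomial.X ((y : V), j) :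
      MvPolynomial (V × Fin 2) ℂ) =
      MvPolynomial.monomial (Finsupp.single ((x : V), i) 1 + Finsupp.single ((y : V), j) 1) 1 :=
    fun i j => by simp [MvPolynomial.X, MvPolynomial.monomial_mul]
  have hle : ∀ (i j : Fin 2) (E : V × Fin 2 →₀ ℕ),
      Finsupp.single ((x : V), i) 1 + Finsupp.single ((y : V), j) 1 ≤ E ↔
        1 ≤ E (x, i) ∧ 1 ≤ E (y, j) := fun i j E =>
    single_add_single_le_iff (by simp [hxy']) E
  simp_rw [sub_mul, MvPolynomial.coeff_sub, mul_sub, hm, MvPolynomial.coeff_monomial_mul', hle,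
    exponents_apply_ball_zero hG, exponents_apply_ball_one hG, one_mul, mul_ite, mul_zero]
  rw [Finset.sum_sub_distrib, sub_eq_zero, ← Finset.sum_filter, ← Finset.sum_filter]
  refine Finset.sum_bij' (fun s _ => hop y x s) (fun s _ => hop x y s) ?_ ?_ ?_ ?_ ?_
  · intro s hs
    have hs' := (Finset.mem_filter.1 hs).2
    have h1 := hop_apply_left hxy.symm (s := s) (by omega)
    have h2 := hop_apply_right y x s
    have h3 := (s x).isLt
    refine Finset.mem_filter.2 ⟨Finset.mem_univ _, ?_⟩
    omega
  · intro s hs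
    have hs' := (Finset.mem_filter.1 hs).2
    have h1 := hop_apply_left hxy (s := s) (by omega)
    have h2 := hop_apply_right x y s
    have h3 := (s y).isLt
    refine Finset.mem_filter.2 ⟨Finset.mem_univ _, ?_⟩
    omega
  · intro s hs
    have hs' := (Finset.mem_filter.1 hs).2
    exact hop_hop hxy.symm (by omega) (by omega)
  · intro s hs
    have hs' := (Finset.mem_filter.1 hs).2
    exact hop_hop hxy (by omega) (by omega)
  · intro s hs
    have hs' := (Finset.mem_filter.1 hs).2
    have hsx := (s x).isLt
    have h1 := hop_apply_left hxy.symm (s := s) (by omega)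
    have h2 := hop_apply_right y x s
    have hE := exponents_hop hG hxy (s := hop y x s) (t := s) (by omega) (by omega)
      (fun z hzx hzy => hop_apply_of_ne hzy hzx s) τ
    rw [← hg (hop y x s) (by omega) (by omega), hop_hop hxy.symm (by omega) (by omega)]
    congr 2
    have l1 := (hle 0 1 (exponents G o s τ)).2 (by
      rw [exponents_apply_ball_zero hG, exponents_apply_ball_one hG]; exact hs')
    have l2 := (hle 1 0 (exponents G o (hop y x s) τ)).2 (by
      rw [exponents_apply_ball_zero hG, exponents_apply_ball_one hG]; omega)
    ext p
    have e := DFunLike.congr_fun hE p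
    have e1 := l1 p
    have e2 := l2 p
    rw [Finsupp.tsub_apply, Finsupp.tsub_apply]
    simp only [Finsupp.add_apply] at e e1 e2 ⊢
    omega

/-- The inner product of the valence bond vectors with a state of maximal spin of a bond vanishes. -/
theorem sum_star_mul_vbs_eq_zero (hG : G.IsTree) {x y : ball G o n} (hxy : IsEdge G o x y)
    {w : Config G o d n → ℂ}
    (hw : (totalSpinSq G o x y).mulVec w = ((d : ℂ) * ((d : ℂ) + 1)) • w) (τ : BdryConfig G o n) :
    ∑ s, star (w s) * vbs G o d n s τ = 0 := by
  have hne : x ≠ y := by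
    rintro rfl
    exact G.loopless.irrefl _ hxy.1
  obtain ⟨Q, hQ⟩ := exists_vbsPoly_eq_mul hxy
  have hprod : ∀ s : Config G o d n, ∏ z, ((weylNorm d (s z) : ℝ) : ℂ)⁻¹ =
      ((weylNorm d (s x) * weylNorm d (s y) : ℝ) : ℂ)⁻¹ *
        ∏ z ∈ (Finset.univ.erase x).erase y, ((weylNorm d (s z) : ℝ) : ℂ)⁻¹ := fun s => by
    rw [← Finset.mul_prod_erase _ _ (Finset.mem_univ x),
      ← Finset.mul_prod_erase _ _ (Finset.mem_erase.2 ⟨hne.symm, Finset.mem_univ y⟩)]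
    push_cast
    rw [mul_inv, mul_assoc]
  rw [← sum_mul_coeff_singlet_mul_eq_zero hG hne
    (fun s => star (w s) * ∏ z, ((weylNorm d (s z) : ℝ) : ℂ)⁻¹) ?_ Q τ]
  · refine Finset.sum_congr rfl fun s _ => ?_
    rw [← hQ, vbs, Matrix.of_apply]
    simp only [weylNorm]
    ring
  · intro s hx hy
    have h1 := hop_apply_left hne hx
    have h2 := hop_apply_right x y s
    have h := hop_eq_of_totalSpinSq_mulVec hne hw s (i := hop x y s x) (j := hop x y s y) h1
      (by omega)
    have hs : Function.update (Function.update s x (hop x y s x)) y (hop x y s y) =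
        hop x y s := by
      funext z
      by_cases hzy : z = y
      · subst hzy; simp
      · by_cases hzx : z = x
        · subst hzx; simp [hzy]
        · simp [hzx, hzy, hop_apply_of_ne]
    rw [hs] at h
    have h' := congrArg star h
    simp only [star_mul', star_inv₀, Complex.star_def, Complex.conj_ofReal] at h'
    simp only [Complex.star_def]
    rw [hprod, hprod, ← mul_assoc, ← mul_assoc, h']
    congr 1
    refine Finset.prod_congr rfl fun z hz => ?_
    rw [hop_apply_of_ne (Finset.mem_erase.1 (Finset.mem_erase.1 hz).2).1 (Finset.mem_erase.1 hz).1]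

theorem hamiltonian_apply_eq_zero (hG : G.IsTree)
    (M : Matrix (BdryConfig G o n) (Config G o d n) ℂ) (φ : EuclideanSpace ℂ (Config G o d n)) :
    hamiltonian G o d n (Matrix.toEuclideanLin (vbs G o d n * M) φ) = 0 := by
  classical
  rw [hamiltonian, sum_apply]
  refine Finset.sum_eq_zero fun x _ => ?_
  rw [sum_apply]
  refine Finset.sum_eq_zero fun y _ => ?_
  split_ifs with hxy
  · rw [Submodule.starProjection_apply_eq_zero_iff, Submodule.mem_orthogonal]
    intro w hw
    have hw' : (totalSpinSq G o x y).mulVec w.ofLp = ((d : ℂ) * ((d : ℂ) + 1)) • w.ofLp :=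
      congrArg WithLp.ofLp (Module.End.mem_eigenspace_iff.1 hw)
    rw [Matrix.toLpLin_apply, ← Matrix.mulVec_mulVec, EuclideanSpace.inner_eq_star_dotProduct,
      dotProduct_comm, Matrix.dotProduct_mulVec]
    have : Matrix.vecMul (star w.ofLp) (vbs G o d n) = 0 := by
      funext τ
      exact sum_star_mul_vbs_eq_zero hG hxy hw' τ
    rw [this, zero_dotProduct]
  · rfl

end Energy

/-! ### Compatible Néel states and their infinite-volume limits. -/

section States

variable {V : Type*} {G : SimpleGraph V} [G.LocallyFinite] {o : V} {d n : ℕ}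

theorem bdryProd_posSemidef {b : Fin 2 → ℝ} (hb : ∀ i, 0 ≤ b i) :
    (bdryProd G o n b).PosSemidef :=
  Matrix.PosSemidef.diagonal fun τ => Finset.prod_nonneg fun y _ => Complex.zero_le_real.2 (hb (τ y))

variable [DecidableEq V]

theorem embed_refl (A : Obs G o d n) : embed G o le_rfl A = A := by
  ext s t
  rw [embed, Matrix.of_apply, if_pos]
  exact fun z hz => absurd z.2 hz

theorem embed_embed {k m : ℕ} (h : k ≤ m) (h' : m ≤ n) (A : Obs G o d k) :
    embed G o h' (embed G o h A) = embed G o (h.trans h') A := by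
  ext s t
  simp only [embed, Matrix.of_apply]
  rw [← ite_and]
  refine if_congr ⟨?_, ?_⟩ rfl rfl
  · rintro ⟨h1, h2⟩ z hz
    by_cases hzm : (z : V) ∈ ball G o m
    · exact h2 ⟨z, hzm⟩ hz
    · exact h1 z hzm
  · intro h1
    exact ⟨fun z hz => h1 z fun hzk => hz (ball_mono G o h hzk), fun z hz => h1 _ hz⟩

theorem embed_one {m : ℕ} (h : m ≤ n) : embed G o h (1 : Obs G o d m) = 1 := by
  ext s t
  simp only [embed, Matrix.of_apply, Matrix.one_apply]
  rw [← ite_and]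
  refine if_congr ⟨?_, ?_⟩ rfl rfl
  · rintro ⟨h1, h2⟩
    funext z
    by_cases hz : (z : V) ∈ ball G o m
    · exact congrFun h2 ⟨z, hz⟩
    · exact h1 z hz
  · rintro rfl
    exact ⟨fun _ _ => rfl, rfl⟩

theorem embed_succ_apply (hG : G.IsTree) (A : Obs G o d n) (s t : Config G o d n)
    (r r' : layer G o (n + 1) → Fin (d + 1)) :
    embed G o n.le_succ A (configSuccEquiv hG o d n (s, r)) (configSuccEquiv hG o d n (t, r')) =
      if r = r' then A s t else 0 := by
  have hA : ∀ (s : Config G o d n) (r : layer G o (n + 1) → Fin (d + 1)) (x : ball G o n),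
      configSuccEquiv hG o d n (s, r) ⟨x, ball_mono G o n.le_succ x.2⟩ = s x := fun s r x =>
    configSuccEquiv_inl hG s r x
  simp only [embed, Matrix.of_apply, hA]
  refine if_congr ⟨fun h => ?_, ?_⟩ rfl rfl
  · funext x
    have := h (ballSuccEquiv hG o n (Sum.inr x)) fun hx => ball_ne_layer hG ⟨_, hx⟩ x rfl
    simpa using this
  · rintro rfl z hz
    obtain ⟨x | x, rfl⟩ := (ballSuccEquiv hG o n).surjective z
    · exact absurd x.2 hz
    · simp

theorem trace_unnormalized_succ_mul_embed (hG : G.IsTree) (hdeg : G.IsRegularOfDegree d)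
    (b : Fin 2 → ℝ) (A : Obs G o d n) :
    (unnormalized G o d (n + 1) b * embed G o n.le_succ A).trace =
      (unnormalized G o d n (transferWeight d b) * A).trace := by
  simp only [Matrix.trace, Matrix.diag, Matrix.mul_apply]
  simp only [← (configSuccEquiv hG o d n).sum_comp, Fintype.sum_prod_type, embed_succ_apply,
    mul_ite, mul_zero, Finset.sum_ite_eq', Finset.mem_univ, if_true,
    ← sum_unnormalized_succ hG hdeg, Finset.sum_mul]
  exact Finset.sum_congr rfl fun s _ => Finset.sum_comm

theorem unnormalized_smul (c : ℝ) (b : Fin 2 → ℝ) :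
    unnormalized G o d n (c • b) =
      ((c : ℂ) ^ Fintype.card (layer G o (n + 1))) • unnormalized G o d n b := by
  ext s t
  rw [Matrix.smul_apply, unnormalized_apply, unnormalized_apply, Finset.smul_sum]
  refine Finset.sum_congr rfl fun τ _ => ?_
  simp only [Pi.smul_apply, smul_eq_mul, Complex.ofReal_mul, Finset.prod_mul_distrib,
    Finset.prod_const, Finset.card_univ]
  ring

theorem unnormalized_posSemidef {b : Fin 2 → ℝ} (hb : ∀ i, 0 ≤ b i) :
    (unnormalized G o d n b).PosSemidef :=
  (bdryProd_posSemidef hb).mul_mul_conjTranspose_same _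

theorem childCount_parent_pos (hG : G.IsTree) (τ : BdryConfig G o n) (y : layer G o (n + 1)) :
    0 < childCount hG τ (parent hG n y) (τ y) :=
  Finset.card_pos.2 ⟨y, by simp⟩

theorem childCount_const_of_ne (hG : G.IsTree) {i j : Fin 2} (h : i ≠ j) (x : layer G o n) :
    childCount hG (fun _ => i) x j = 0 := by
  simp [childCount, h]

/-- An extreme spin at the root forces all boundary spins of `T_0` to be equal, so a single term
remains. This makes the extreme diagonal entries explicit enough to tell the two states apart. -/
theorem unnormalized_zero_apply (hG : G.IsTree) (hdeg : G.IsRegularOfDegree d) (b : Fin 2 → ℝ)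
    {j : Fin (d + 1)} {i : Fin 2} (h : ∀ x, (j : ℕ) = childCount hG (fun _ : layer G o 1 => i) x 0)
    (h' : ∀ τ : BdryConfig G o 0, (∀ x, (j : ℕ) = childCount hG τ x 0) → ∀ y, τ y = i) :
    unnormalized G o d 0 b (fun _ => j) (fun _ => j) =
      (b i : ℂ) ^ Fintype.card (layer G o 1) *
        ((weylNorm d j : ℂ)⁻¹ ^ Fintype.card (ball G o 0)) ^ 2 := by
  rw [unnormalized_apply, Finset.sum_eq_single fun _ => i]
  · rw [vbs_zero hG hdeg, Finset.prod_congr rfl fun x _ => if_pos (h _)]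
    have hs : ((-1 : ℂ) ^ (i : ℕ)) * (-1) ^ (i : ℕ) = 1 := by rw [← mul_pow]; simp
    simp only [Finset.prod_const, Finset.card_univ, star_mul', star_pow, star_inv₀, star_neg,
      star_one, Complex.star_def, Complex.conj_ofReal]
    rw [mul_mul_mul_comm, ← mul_pow ((-1 : ℂ) ^ (i : ℕ)), hs, one_pow, one_mul, sq]
  · intro τ _ hτ
    have : ∃ x, (j : ℕ) ≠ childCount hG τ x 0 := by
      by_contra! hc
      exact hτ (funext (h' τ hc))
    obtain ⟨x, hx⟩ := this
    rw [vbs_zero hG hdeg, Finset.prod_eq_zero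
      (Finset.mem_univ (⟨x, (ball_zero_eq_layer hG).symm ▸ x.2⟩ : ball G o 0)) (if_neg hx)]
    simp
  · simp

theorem unnormalized_zero_apply_zero (hG : G.IsTree) (hdeg : G.IsRegularOfDegree d)
    (b : Fin 2 → ℝ) : unnormalized G o d 0 b (fun _ => 0) (fun _ => 0) =
      (b 1 : ℂ) ^ Fintype.card (layer G o 1) *
        ((weylNorm d 0 : ℂ)⁻¹ ^ Fintype.card (ball G o 0)) ^ 2 := by
  refine unnormalized_zero_apply hG hdeg b (fun x => ?_) fun τ hτ y => ?_
  · rw [childCount_const_of_ne hG (by decide)]; rfl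
  · by_contra hy
    have hy0 : τ y = 0 := by omega
    have h1 := childCount_parent_pos hG τ y
    rw [hy0, ← hτ] at h1
    exact lt_irrefl _ h1

theorem unnormalized_zero_apply_last (hG : G.IsTree) (hdeg : G.IsRegularOfDegree d)
    (b : Fin 2 → ℝ) : unnormalized G o d 0 b (fun _ => Fin.last d) (fun _ => Fin.last d) =
      (b 0 : ℂ) ^ Fintype.card (layer G o 1) *
        ((weylNorm d 0 : ℂ)⁻¹ ^ Fintype.card (ball G o 0)) ^ 2 := by
  have hN : weylNorm d (Fin.last d : Fin (d + 1)) = weylNorm d 0 := by simp [weylNorm]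
  rw [← hN]
  refine unnormalized_zero_apply hG hdeg b (fun x => ?_) fun τ hτ y => ?_
  · have h1 := childCount_zero_add_one hG (fun _ : layer G o 1 => (0 : Fin 2)) x
    rw [childCount_const_of_ne hG (by decide : (0 : Fin 2) ≠ 1), card_fiber_parent_zero hG hdeg]
      at h1
    exact h1.symm
  · by_contra hy
    have hy0 : τ y = 1 := by omega
    have h1 := childCount_parent_pos hG τ y
    have h2 := childCount_zero_add_one hG τ (parent hG 0 y)
    rw [card_fiber_parent_zero hG hdeg, ← hτ] at h2
    rw [hy0] at h1
    simp only [Fin.val_last] at h2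
    omega

theorem neelWeight_pos {r : ℝ} (hr : 0 < r) (k : ℕ) (i : Fin 2) : 0 < neelWeight r k i := by
  rw [neelWeight]
  obtain rfl | rfl : i = 0 ∨ i = 1 := by omega
  all_goals split_ifs <;> simp [hr]

/-- At `n = 0` a positive semidefinite matrix of trace zero would vanish, but one diagonal entry is
nonzero. Each further layer multiplies the trace by a power of `c`. -/
theorem trace_unnormalized_ne_zero (hG : G.IsTree) (hdeg : G.IsRegularOfDegree d) {r c : ℝ}
    (hr : 0 < r) (hc : 0 < c)
    (h : ∀ k, transferWeight d (neelWeight r (k + 1)) = c • neelWeight r k) (k n : ℕ) :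
    (unnormalized G o d n (neelWeight r (n + k))).trace ≠ 0 := by
  induction n with
  | zero =>
    intro h0
    have hp := unnormalized_posSemidef (G := G) (o := o) (d := d) (n := 0)
      (b := neelWeight r (0 + k)) fun i => (neelWeight_pos hr _ i).le
    have h1 := unnormalized_zero_apply_zero (o := o) hG hdeg (neelWeight r (0 + k))
    rw [hp.trace_eq_zero_iff.1 h0, Matrix.zero_apply, eq_comm] at h1
    have h2 : (weylNorm d 0 : ℂ) ≠ 0 := by exact_mod_cast (weylNorm_pos (Nat.zero_le d)).ne'
    have h3 : (neelWeight r (0 + k) 1 : ℂ) ≠ 0 := by exact_mod_cast (neelWeight_pos hr _ 1).ne'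
    exact mul_ne_zero (pow_ne_zero _ h3) (pow_ne_zero _ (pow_ne_zero _ (inv_ne_zero h2))) h1
  | succ n ih =>
    have h1 := trace_unnormalized_succ_mul_embed (o := o) (n := n) hG hdeg
      (neelWeight r (n + k + 1)) 1
    rw [embed_one, mul_one, mul_one, h, unnormalized_smul, Matrix.trace_smul, smul_eq_mul] at h1
    rw [add_right_comm, h1]
    exact mul_ne_zero (pow_ne_zero _ (by exact_mod_cast hc.ne')) ih

/-- The transferred weights are the Néel weights up to the factor `c`, whose power cancels between
numerator and normalization. The latter is treated as the expectation of `1`. -/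
theorem trace_density_succ_mul_embed (hG : G.IsTree) (hdeg : G.IsRegularOfDegree d) {r c : ℝ}
    (hc : 0 < c) (h : ∀ k, transferWeight d (neelWeight r (k + 1)) = c • neelWeight r k)
    (k n : ℕ) (A : Obs G o d n) :
    (density (d := d) G o (bdryProd G o (n + 1) (neelWeight r (n + 1 + k))) *
      embed G o n.le_succ A).trace =
      (density (d := d) G o (bdryProd G o n (neelWeight r (n + k))) * A).trace := by
  have hd : ∀ (n : ℕ) (b : Fin 2 → ℝ) (A : Obs G o d n),
      (density (d := d) G o (bdryProd G o n b) * A).trace =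
        (unnormalized G o d n b * 1).trace⁻¹ * (unnormalized G o d n b * A).trace :=
    fun n b A => by
      rw [mul_one, density, smul_mul_assoc, Matrix.trace_smul, smul_eq_mul]
      rfl
  have hc' : ((c : ℂ) ^ Fintype.card (layer G o (n + 1))) ≠ 0 :=
    pow_ne_zero _ (by exact_mod_cast hc.ne')
  rw [hd, hd, ← embed_one n.le_succ, trace_unnormalized_succ_mul_embed hG hdeg,
    trace_unnormalized_succ_mul_embed hG hdeg, add_right_comm, h, unnormalized_smul,
    smul_mul_assoc, smul_mul_assoc, Matrix.trace_smul, Matrix.trace_smul, smul_eq_mul, smul_eq_mul,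
    mul_inv, mul_mul_mul_comm, inv_mul_cancel₀ hc', one_mul]

theorem trace_density_mul_embed (hG : G.IsTree) (hdeg : G.IsRegularOfDegree d) {r c : ℝ}
    (hc : 0 < c) (h : ∀ k, transferWeight d (neelWeight r (k + 1)) = c • neelWeight r k)
    (k : ℕ) {m n : ℕ} (hmn : m ≤ n) (A : Obs G o d m) :
    (density (d := d) G o (bdryProd G o n (neelWeight r (n + k))) * embed G o hmn A).trace =
      (density (d := d) G o (bdryProd G o m (neelWeight r (m + k))) * A).trace := by
  induction n, hmn using Nat.le_induction with
  | base => rw [embed_refl]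
  | succ n hmn ih =>
    rw [← embed_embed hmn n.le_succ, trace_density_succ_mul_embed hG hdeg hc h, ih]

theorem isFiniteVolumeGroundState_density (hG : G.IsTree) {b : Fin 2 → ℝ} (hb : ∀ i, 0 ≤ b i)
    (hZ : (unnormalized G o d n b).trace ≠ 0) :
    IsFiniteVolumeGroundState G o (density (d := d) G o (bdryProd G o n b)) := by
  have hp := unnormalized_posSemidef (G := G) (o := o) (d := d) (n := n) hb
  refine ⟨hp.smul (inv_nonneg.2 hp.trace_nonneg), ?_, fun φ => ?_⟩
  · rw [density, Matrix.trace_smul, smul_eq_mul]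
    exact inv_mul_cancel₀ hZ
  · rw [density, Matrix.mul_assoc, ← Matrix.mul_smul]
    exact hamiltonian_apply_eq_zero hG _ φ

/-- A local observable at the root as a quasi-local observable. -/
noncomputable def QuasiLocalObs.ofRoot (A : Obs G o d 0) : QuasiLocalObs G o d where
  obs n := embed G o n.zero_le A
  cauchy ε hε := ⟨0, fun n h => by
    rw [embed_embed, sub_self, map_zero, norm_zero]
    exact hε.le⟩

/-- The Néel ordered ground state, with the order of the sublattices depending on the parity
of `k`. -/
theorem exists_isInfiniteVolumeGroundState (hG : G.IsTree) (hdeg : G.IsRegularOfDegree d)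
    {r c : ℝ} (hr : 0 < r) (hc : 0 < c)
    (h : ∀ k, transferWeight d (neelWeight r (k + 1)) = c • neelWeight r k) (k : ℕ) :
    ∃ ω : QuasiLocalObs G o d → ℂ, IsInfiniteVolumeGroundState G o ω ∧
      ∀ A : Obs G o d 0, ω (QuasiLocalObs.ofRoot A) =
        (unnormalized G o d 0 (neelWeight r k)).trace⁻¹ *
          (unnormalized G o d 0 (neelWeight r k) * A).trace := by
  have hgs : ∀ n, IsFiniteVolumeGroundState G o
      (density (d := d) G o (bdryProd G o n (neelWeight r (n + k)))) := fun n =>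
    isFiniteVolumeGroundState_density hG (fun i => (neelWeight_pos hr _ i).le)
      (trace_unnormalized_ne_zero hG hdeg hr hc h k n)
  have hlim : ∀ A : QuasiLocalObs G o d, ∃ z : ℂ, Filter.Tendsto (fun n =>
      (density (d := d) G o (bdryProd G o n (neelWeight r (n + k))) * A.obs n).trace)
      Filter.atTop (nhds z) := by
    intro A
    refine cauchySeq_tendsto_of_complete (Metric.cauchySeq_iff'.2 fun ε hε => ?_)
    obtain ⟨N, hN⟩ := A.cauchy (ε / 2) (half_pos hε)
    refine ⟨N, fun n hn => ?_⟩
    -- By compatibility the value at `N` is also an expectation in the state on `T_n`, so the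
    -- difference is bounded by `‖obs n - embed (obs N)‖`.
    rw [dist_eq_norm, ← trace_density_mul_embed hG hdeg hc h k hn, ← Matrix.trace_sub, ← mul_sub]
    have := norm_trace_mul_le_of_posSemidef (hgs n).1 (hgs n).2.1 (A.obs n - embed G o hn (A.obs N))
    linarith [hN n hn]
  choose ω hω using hlim
  refine ⟨ω, ⟨fun n => bdryProd G o n (neelWeight r (n + k)), fun n => ⟨bdryProd_posSemidef
    fun i => (neelWeight_pos hr _ i).le, hgs n⟩, hω⟩, fun A => ?_⟩
  refine tendsto_nhds_unique (hω _) (tendsto_const_nhds.congr fun n => ?_)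
  rw [QuasiLocalObs.ofRoot, trace_density_mul_embed hG hdeg hc h, density, smul_mul_assoc,
    Matrix.trace_smul, smul_eq_mul]
  change _ = (unnormalized G o d 0 (neelWeight r (0 + k))).trace⁻¹ *
    (unnormalized G o d 0 (neelWeight r (0 + k)) * A).trace
  rw [zero_add]

end States

end AKLT

/-! ### The two Néel states differ at the root. -/

theorem mainTheorem6 {V : Type*} [DecidableEq V] (G : SimpleGraph V) [G.LocallyFinite] (o : V) (d : ℕ)
    (hd : 5 ≤ d) (hG : G.IsTree) (hdeg : G.IsRegularOfDegree d) :
    ∃ ω₁ ω₂ : AKLT.QuasiLocalObs G o d → ℂ,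
      AKLT.IsInfiniteVolumeGroundState G o ω₁ ∧ AKLT.IsInfiniteVolumeGroundState G o ω₂ ∧
        ω₁ ≠ ω₂ := by
  open AKLT in
  obtain ⟨r, c, hr, hr1, hc, h⟩ := exists_neelWeight hd
  obtain ⟨ω₁, h₁, h₁'⟩ := exists_isInfiniteVolumeGroundState (o := o) hG hdeg hr hc h 0
  obtain ⟨ω₂, h₂, h₂'⟩ := exists_isInfiniteVolumeGroundState (o := o) hG hdeg hr hc h 1
  refine ⟨ω₁, ω₂, h₁, h₂, ?_⟩
  rintro rfl
  have hZ₂ := trace_unnormalized_ne_zero (o := o) hG hdeg hr hc h 1 0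
  rw [zero_add] at hZ₂
  have key : ∀ s : Config G o d 0,
      (unnormalized G o d 0 (neelWeight r 0)).trace⁻¹ * unnormalized G o d 0 (neelWeight r 0) s s =
      (unnormalized G o d 0 (neelWeight r 1)).trace⁻¹ *
        unnormalized G o d 0 (neelWeight r 1) s s := by
    intro s
    have := (h₁' (Matrix.single s s 1)).symm.trans (h₂' (Matrix.single s s 1))
    simpa [Matrix.trace_mul_single] using this
  have h0 := key fun _ => 0
  have hl := key fun _ => Fin.last d
  have hN : (weylNorm d 0 : ℂ) ≠ 0 := by exact_mod_cast (weylNorm_pos (Nat.zero_le d)).ne'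
  have hK : ((weylNorm d 0 : ℂ)⁻¹ ^ Fintype.card (ball G o 0)) ^ 2 ≠ 0 :=
    pow_ne_zero _ (pow_ne_zero _ (inv_ne_zero hN))
  rw [unnormalized_zero_apply_zero hG hdeg, unnormalized_zero_apply_zero hG hdeg, ← mul_assoc,
    ← mul_assoc] at h0
  rw [unnormalized_zero_apply_last hG hdeg, unnormalized_zero_apply_last hG hdeg, ← mul_assoc,
    ← mul_assoc] at hl
  replace h0 := mul_right_cancel₀ hK h0
  replace hl := mul_right_cancel₀ hK hl
  generalize (unnormalized G o d 0 (neelWeight r 0)).trace = Z₁ at h0 hl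
  generalize (unnormalized G o d 0 (neelWeight r 1)).trace = Z₂ at h0 hl hZ₂
  simp only [neelWeight, Even.zero, Nat.not_even_one, if_true, if_false, Matrix.cons_val_zero,
    Matrix.cons_val_one, Complex.ofReal_one, one_pow, mul_one] at h0 hl
  have hcard : Fintype.card (layer G o 1) ≠ 0 := by
    intro h0
    have hx : o ∈ layer G o 0 := (mem_layer_iff hG).2 (SimpleGraph.dist_self)
    have h1 := card_fiber_parent_zero hG hdeg ⟨o, hx⟩
    have h2 := Fintype.card_subtype_le fun y => parent hG 0 y = ⟨o, hx⟩
    rw [h1] at h2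
    change d ≤ Fintype.card (layer G o 1) at h2
    omega
  have hlt : (r ^ Fintype.card (layer G o 1)) ^ 2 < 1 :=
    pow_lt_one₀ (by positivity) (pow_lt_one₀ hr.le hr1 hcard) two_ne_zero
  -- With `R = r ^ N`, equality of the states at the two extreme spin values reads `Z₁⁻¹ = Z₂⁻¹ R`
  -- and `Z₁⁻¹ R = Z₂⁻¹`; eliminating `Z₁` gives `R² = 1`.
  have heq : ((r : ℂ) ^ Fintype.card (layer G o 1)) ^ 2 = 1 := by
    rw [h0] at hl
    have := inv_ne_zero hZ₂
    refine mul_left_cancel₀ this ?_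
    linear_combination hl
  have : (r ^ Fintype.card (layer G o 1)) ^ 2 = 1 := by exact_mod_cast heq
  linarith
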